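/- Let $\Omega\subset\mathbb C$ be an arbitrary set, $f\colon\Omega\to\mathbb C$ an arbitrary function, and $k\ge 2$. Notation. $\Omega'$ is the set of all $z\in\Omega$ lying in the closure of $\Omega\setminus\{z\}$. $\mathcal M_k(\Omega)$ is the set of complex $k\times k$ matrices $X$ whose spectrum is contained in $\Omega$; $\mathcal D_k(\Omega)$ is the set of all diagonalizable $X\in\mathcal M_k(\Omega)$; $\mathcal M_k^o(\Omega)$ is the set of all $X\in\mathcal M_k(\Omega)$ such that every multiple root of the minimal polynomial $\mu_X$ belongs to $\Omega'$ (so $\mathcal D_k(\Omega)\subset\mathcal M_k^o(\Omega)$). These sets carry the topology of $\mathcal M_k(\mathbb C)=\mathbb C^{k\times k}$. For $X\in\mathcal D_k(\Omega)$ put $f_{\mathrm{op}}(X)=f[X]:=W[X]$, where $W$ is any polynomial with $W=f$ on the spectrum of $X$. For an integer $m\ge1$, $f$ is of class $TC^m$ if for each $a\in\Omega'$ there are numbers $f^{(0)}(a),\dots,f^{(m)}(a)\in\mathbb C$ and a function $\tau_a\colon\Omega\to\mathbb C$, continuous at $a$ with $\tau_a(a)=0$, such that $f(z)=\sum_{j=0}^m\frac{f^{(j)}(a)}{j!}(z-a)^j+\tau_a(z)(z-a)^m$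 for all $z\in\Omega$ (these numbers and $\tau_a$ are then unique, and $f^{(0)}(a)=f(a)$), and if the functions $f^{(1)},\dots,f^{(m)}\colon\Omega'\to\mathbb C$ and $\Omega'\times\Omega\ni(a,x)\mapsto\tau_a(x)\in\mathbb C$ are continuous. If $f$ is of class $TC^{k-1}$ and $X\in\mathcal M_k^o(\Omega)$ has minimal polynomial $\mu_X(z)=\prod_{j}(z-\lambda_j)^{p_j}$ with distinct $\lambda_j$, put $f_{\mathrm{op}}(X)=f[X]:=P[X]$, where $P$ is any polynomial such that $P^{(s)}(\lambda_j)=f^{(s)}(\lambda_j)$ for $0\le s<p_j$ whenever $\lambda_j\in\Omega'$, and $P(\lambda_j)=f(\lambda_j)$ whenever $\lambda_j\notin\Omega'$. The result does not depend on $P$, and on $\mathcal D_k(\Omega)$ it agrees with the previous definition. For pairwise distinct $z_1,\dots,z_n\in\Omega$ the divided differences are $\Delta(z)f=f(z)$ and, for $n>1$, $\Delta(z_1,\dots,z_n)f=\dfrac{\Delta(z_2,\dots,z_n)f-\Delta(z_1,\dots,z_{n-1})f}{z_n-z_1}$. The function $f$ is of class $DDC^{k-1}(\Omega)$ if for each $z\in\Omega'$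 the function $(z_1,\dots,z_k)\mapsto\Delta(z_1,\dots,z_k)f$, defined on the $k$-tuples of pairwise distinct points of $\Omega$, has a finite limit at $(z,\dots,z)$. Then the following conditions are equivalent: (i) $f_{\mathrm{op}}\colon\mathcal D_k(\Omega)\to\mathcal M_k(\mathbb C)$ extends to a continuous function from $\mathcal M_k^o(\Omega)$ to $\mathcal M_k(\mathbb C)$; (ii) $f$ is of class $TC^{k-1}$ and $f_{\mathrm{op}}\colon\mathcal M_k^o(\Omega)\to\mathcal M_k(\mathbb C)$ is continuous; (iii) $f\in DDC^{k-1}(\Omega)$. -/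

import Mathlib

open Polynomial Filter Topology

namespace MatCalc

/-! ### Cluster points and T-differentiability -/

/-- `Ω'`: the cluster points of `Ω` that belong to `Ω`, as a subset of the type `Ω`. -/
def clusterPts (Ω : Set ℂ) : Set Ω :=
  {z | (z : ℂ) ∈ closure (Ω \ {(z : ℂ)})}

/-- The Taylor expansion of order `k` of `f` at `a`, with coefficients `u 0, …, u k` and
remainder `τ`:
`f z = ∑_{j ≤ k} u j / j! * (z - a) ^ j + τ z * (z - a) ^ k` on `Ω`, where `τ a = 0` and `τ` is
continuous at `a`. -/
structure IsTaylor {Ω : Set ℂ} (f : Ω → ℂ) (k : ℕ) (a : Ω) (u : ℕ → ℂ) (τ : Ω → ℂ) : Prop where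
  expansion : ∀ z : Ω, f z =
    ∑ j ∈ Finset.range (k + 1), u j / (j.factorial : ℂ) * ((z : ℂ) - (a : ℂ)) ^ j
      + τ z * ((z : ℂ) - (a : ℂ)) ^ k
  remainder_zero : τ a = 0
  remainder_continuousAt : ContinuousAt τ a

/-- `f` is `k` times T-differentiable at `a` (used for `k ≥ 1` and `a ∈ Ω'`). -/
def TDifferentiableAt {Ω : Set ℂ} (f : Ω → ℂ) (k : ℕ) (a : Ω) : Prop :=
  ∃ (u : ℕ → ℂ) (τ : Ω → ℂ), IsTaylor f k a u τ

open Classical in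
/-- The `j`-th T-derivative `f^{(j)}(a)`: `f^{(0)} = f`, and for `j ≥ 1` it is the coefficient
`u j` of an order `j` Taylor expansion at `a ∈ Ω'` (`0` if there is none). By `IsTaylor.tDeriv_eq`
below it is also the coefficient `u j` of every expansion at `a` of an order `k ≥ j`, `k ≥ 1`. -/
noncomputable def tDeriv {Ω : Set ℂ} (f : Ω → ℂ) : ℕ → Ω → ℂ
  | 0, a => f a
  | j + 1, a => if h : TDifferentiableAt f (j + 1) a then h.choose (j + 1) else 0

/-- `f` is of class `TC^k`: for `k = 0` this means continuity; for `k ≥ 1`, `f` is `k` times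
T-differentiable at each point of `Ω'`, the T-derivatives of orders `1, …, k` are continuous
on `Ω'`, and the remainder `(a, x) ↦ τ_a(x)` is continuous on `Ω' × Ω`. -/
def IsTC {Ω : Set ℂ} (f : Ω → ℂ) : ℕ → Prop
  | 0 => Continuous f
  | k + 1 => ∃ (u : clusterPts Ω → ℕ → ℂ) (τ : clusterPts Ω → Ω → ℂ),
      (∀ a : clusterPts Ω, IsTaylor f (k + 1) a (u a) (τ a)) ∧
      (∀ j, 1 ≤ j → j ≤ k + 1 → Continuous fun a : clusterPts Ω => u a j) ∧
      Continuous fun p : clusterPts Ω × Ω => τ p.1 p.2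

/-! ### Divided differences -/

/-- The divided difference `Δ(z_1, …, z_n) f` (here `n = m + 1`, indices start at `0`). -/
noncomputable def dividedDiff {Ω : Set ℂ} (f : Ω → ℂ) : (m : ℕ) → (Fin (m + 1) → Ω) → ℂ
  | 0, z => f (z 0)
  | m + 1, z =>
      (dividedDiff f m (fun i => z i.succ) - dividedDiff f m (fun i => z i.castSucc)) /
        ((z (Fin.last (m + 1)) : ℂ) - (z 0 : ℂ))

/-- `f` is of class `DDC^m`: the divided differences over `m + 1` distinct points of `Ω` have
a finite limit at `(z, …, z)` for each `z ∈ Ω'`. -/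
def IsDDC {Ω : Set ℂ} (f : Ω → ℂ) (m : ℕ) : Prop :=
  ∀ z ∈ clusterPts Ω, ∃ L : ℂ,
    Tendsto (dividedDiff f m)
      (𝓝[{v : Fin (m + 1) → Ω | Function.Injective v}] (fun _ => z)) (𝓝 L)

/-! ### Sets of matrices -/

/-- `M_k(Ω)`: the `k × k` complex matrices with spectrum in `Ω`. -/
def specMat (Ω : Set ℂ) (k : ℕ) : Set (Matrix (Fin k) (Fin k) ℂ) :=
  {X | spectrum ℂ X ⊆ Ω}

/-- A matrix is diagonalizable if it is similar to a diagonal one. -/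
def IsDiagonalizable {k : ℕ} (X : Matrix (Fin k) (Fin k) ℂ) : Prop :=
  ∃ (P : (Matrix (Fin k) (Fin k) ℂ)ˣ) (d : Fin k → ℂ),
    (P : Matrix (Fin k) (Fin k) ℂ) * X * ((P⁻¹ : (Matrix (Fin k) (Fin k) ℂ)ˣ) :
      Matrix (Fin k) (Fin k) ℂ) = Matrix.diagonal d

/-- `D_k(Ω)`: the diagonalizable matrices in `M_k(Ω)`. -/
def diagMat (Ω : Set ℂ) (k : ℕ) : Set (Matrix (Fin k) (Fin k) ℂ) :=
  {X | X ∈ specMat Ω k ∧ IsDiagonalizable X}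

/-- `M_k^o(Ω)`: the matrices in `M_k(Ω)` such that all multiple roots of the minimal polynomial
belong to `Ω'`. -/
def extMat (Ω : Set ℂ) (k : ℕ) : Set (Matrix (Fin k) (Fin k) ℂ) :=
  {X | X ∈ specMat Ω k ∧ ∀ w : ℂ, 2 ≤ (minpoly ℂ X).rootMultiplicity w →
    ∃ hw : w ∈ Ω, (⟨w, hw⟩ : Ω) ∈ clusterPts Ω}

/-! ### Interpolation conditions -/

/-- `W` agrees with `f` on the spectrum of `X`. -/
def IsInterp {Ω : Set ℂ} (f : Ω → ℂ) {k : ℕ} (X : Matrix (Fin k) (Fin k) ℂ) (W : ℂ[X]) : Prop :=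
  ∀ w : Ω, (w : ℂ) ∈ spectrum ℂ X → W.eval (w : ℂ) = f w

/-- The conditions on the polynomial `P` in the definition of `f[X]`: for each root `w` of the
minimal polynomial of `X`, of multiplicity `p`, `P^{(s)}(w) = f^{(s)}(w)` for all `s < p`
if `w ∈ Ω'`, and `P(w) = f(w)` if `w ∉ Ω'`. -/
def IsExtInterp {Ω : Set ℂ} (f : Ω → ℂ) {k : ℕ} (X : Matrix (Fin k) (Fin k) ℂ)
    (P : ℂ[X]) : Prop :=
  ∀ w : Ω, (minpoly ℂ X).IsRoot (w : ℂ) →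
    (w ∈ clusterPts Ω → ∀ s < (minpoly ℂ X).rootMultiplicity (w : ℂ),
      (derivative^[s] P).eval (w : ℂ) = tDeriv f s w) ∧
    (w ∉ clusterPts Ω → P.eval (w : ℂ) = f w)

/-! ### Facts showing that the notions are well defined -/

lemma taylor_coeff_zero {Ω : Set ℂ} {a : Ω} (ha : a ∈ clusterPts Ω) (k : ℕ) (c : ℕ → ℂ)
    (σ : Ω → ℂ) (hσ : ContinuousAt σ a) (hσ0 : σ a = 0)
    (h : ∀ z : Ω, ∑ j ∈ Finset.range (k + 1), c j * ((z : ℂ) - (a : ℂ)) ^ j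
      + σ z * ((z : ℂ) - (a : ℂ)) ^ k = 0) :
    ∀ j ≤ k, c j = 0 := by
  have hne : (𝓝[≠] a).NeBot := by
    rw [← mem_closure_iff_nhdsWithin_neBot]
    have h1 : (a : ℂ) ∈ closure ((Subtype.val : Ω → ℂ) '' {a}ᶜ) := by
      have h2 : (Subtype.val : Ω → ℂ) '' {a}ᶜ = Ω \ {(a : ℂ)} := by
        ext w
        constructor
        · rintro ⟨v, hv, rfl⟩
          exact ⟨v.2, fun h => hv (Subtype.ext h)⟩
        · rintro ⟨hw, hw'⟩
          exact ⟨⟨w, hw⟩, fun h => hw' (congrArg Subtype.val h), rfl⟩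
      rw [h2]
      exact ha
    exact closure_subtype.2 h1
  intro j
  induction j using Nat.strong_induction_on with
  | _ j ih =>
    intro hj
    have key : ∀ z : Ω, z ≠ a → c j +
        (((z : ℂ) - (a : ℂ)) * ∑ i ∈ Finset.range (k - j),
          c (j + 1 + i) * ((z : ℂ) - (a : ℂ)) ^ i + σ z * ((z : ℂ) - (a : ℂ)) ^ (k - j)) = 0 := by
      intro z hz
      have hz' : ((z : ℂ) - (a : ℂ)) ≠ 0 := sub_ne_zero.2 fun h => hz (Subtype.ext h)
      have hh := h z
      have e1 : k + 1 = j + (k - j + 1) := by omega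
      rw [e1, Finset.sum_range_add, Finset.sum_eq_zero (s := Finset.range j), zero_add,
        Finset.sum_range_succ'] at hh
      · have e2 : ((z : ℂ) - (a : ℂ)) ^ k
            = ((z : ℂ) - (a : ℂ)) ^ j * ((z : ℂ) - (a : ℂ)) ^ (k - j) := by
          rw [← pow_add]; congr 1; omega
        have e3 : ∑ i ∈ Finset.range (k - j), c (j + (i + 1)) * ((z : ℂ) - (a : ℂ)) ^ (j + (i + 1))
            = ((z : ℂ) - (a : ℂ)) ^ j * (((z : ℂ) - (a : ℂ)) * ∑ i ∈ Finset.range (k - j),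
          c (j + 1 + i) * ((z : ℂ) - (a : ℂ)) ^ i) := by
          rw [Finset.mul_sum, Finset.mul_sum]
          refine Finset.sum_congr rfl fun i _ => ?_
          rw [show j + (i + 1) = j + 1 + i by ring]
          ring
        rw [e2, e3] at hh
        have : ((z : ℂ) - (a : ℂ)) ^ j * (c j +
          (((z : ℂ) - (a : ℂ)) * ∑ i ∈ Finset.range (k - j),
            c (j + 1 + i) * ((z : ℂ) - (a : ℂ)) ^ i
              + σ z * ((z : ℂ) - (a : ℂ)) ^ (k - j))) = 0 := by
          rw [← hh]; simp only [add_zero]; ring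
        exact (mul_eq_zero.1 this).resolve_left (pow_ne_zero _ hz')
      · intro i hi
        have hi' := Finset.mem_range.1 hi
        rw [ih i hi' (by omega), zero_mul]
    have hcont : ContinuousAt (fun z : Ω => c j +
        (((z : ℂ) - (a : ℂ)) * ∑ i ∈ Finset.range (k - j),
          c (j + 1 + i) * ((z : ℂ) - (a : ℂ)) ^ i
            + σ z * ((z : ℂ) - (a : ℂ)) ^ (k - j))) a := by
      fun_prop
    have ht := hcont.tendsto.mono_left (nhdsWithin_le_nhds (s := {a}ᶜ))
    have ht' : Tendsto (fun z : Ω => c j +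
        (((z : ℂ) - (a : ℂ)) * ∑ i ∈ Finset.range (k - j),
          c (j + 1 + i) * ((z : ℂ) - (a : ℂ)) ^ i
            + σ z * ((z : ℂ) - (a : ℂ)) ^ (k - j))) (𝓝[≠] a) (𝓝 0) := by
      refine tendsto_const_nhds.congr' ?_
      filter_upwards [self_mem_nhdsWithin] with z hz
      exact (key z hz).symm
    have := tendsto_nhds_unique ht ht'
    simpa [hσ0] using this

lemma IsTaylor.unique {Ω : Set ℂ} {f : Ω → ℂ} {k : ℕ} {a : Ω} (ha : a ∈ clusterPts Ω)
    {u u' : ℕ → ℂ} {τ τ' : Ω → ℂ} (h : IsTaylor f k a u τ) (h' : IsTaylor f k a u' τ') :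
    ∀ j ≤ k, u j = u' j := by
  intro j hj
  have := taylor_coeff_zero ha k (fun j => (u j - u' j) / (j.factorial : ℂ))
    (fun z => τ z - τ' z) (h.remainder_continuousAt.sub h'.remainder_continuousAt)
    (by simp [h.remainder_zero, h'.remainder_zero]) (by
      intro z
      have h1 := h.expansion z
      have h2 := h'.expansion z
      rw [h1] at h2
      simp only [sub_div, sub_mul, Finset.sum_sub_distrib]
      linear_combination h2) j hj
  have hf : (j.factorial : ℂ) ≠ 0 := by exact_mod_cast j.factorial_ne_zero
  rw [div_eq_zero_iff] at this
  exact sub_eq_zero.1 (this.resolve_right hf)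

lemma IsTaylor.of_succ {Ω : Set ℂ} {f : Ω → ℂ} {k : ℕ} {a : Ω} {u : ℕ → ℂ} {τ : Ω → ℂ}
    (h : IsTaylor f (k + 1) a u τ) : ∃ τ', IsTaylor f k a u τ' := by
  refine ⟨fun z => u (k + 1) / ((k + 1).factorial : ℂ) * ((z : ℂ) - (a : ℂ))
    + τ z * ((z : ℂ) - (a : ℂ)), fun z => ?_, by simp, ?_⟩
  · rw [h.expansion z, Finset.sum_range_succ]
    ring
  · have := h.remainder_continuousAt
    fun_prop

lemma IsTaylor.tDeriv_eq {Ω : Set ℂ} {f : Ω → ℂ} {k : ℕ} {a : Ω} (ha : a ∈ clusterPts Ω)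
    {u : ℕ → ℂ} {τ : Ω → ℂ} (h : IsTaylor f k a u τ) : ∀ j ≤ k, tDeriv f j a = u j := by
  induction k generalizing τ with
  | zero =>
    intro j hj
    obtain rfl : j = 0 := by omega
    have := h.expansion a
    simpa [tDeriv, h.remainder_zero] using this
  | succ k ih =>
    intro j hj
    rcases Nat.lt_or_ge j (k + 1) with hlt | hge
    · obtain ⟨τ', h'⟩ := h.of_succ
      exact ih h' j (by omega)
    · obtain rfl : j = k + 1 := by omega
      have hd : TDifferentiableAt f (k + 1) a := ⟨u, τ, h⟩
      have hs := hd.choose_spec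
      obtain ⟨τ', h'⟩ := hs
      simp only [tDeriv, dif_pos hd]
      exact h'.unique ha h _ le_rfl

lemma isRoot_minpoly_iff {k : ℕ} (X : Matrix (Fin k) (Fin k) ℂ) (w : ℂ) :
    (minpoly ℂ X).IsRoot w ↔ w ∈ spectrum ℂ X := by
  rw [← Matrix.spectrum_toLin', ← Matrix.minpoly_toLin', ← Module.End.hasEigenvalue_iff_isRoot,
    Module.End.hasEigenvalue_iff_mem_spectrum]

lemma exists_isInterp {Ω : Set ℂ} (f : Ω → ℂ) {k : ℕ} (X : Matrix (Fin k) (Fin k) ℂ) :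
    ∃ W : ℂ[X], IsInterp f X W := by
  classical
  refine ⟨Lagrange.interpolate (Matrix.finite_spectrum X).toFinset id
    (fun w => if hw : w ∈ Ω then f ⟨w, hw⟩ else 0), fun w hw => ?_⟩
  have h := Lagrange.eval_interpolate_at_node (s := (Matrix.finite_spectrum X).toFinset) (v := id)
    (fun w => if hw : w ∈ Ω then f ⟨w, hw⟩ else 0) (Function.injective_id.injOn)
    (i := (w : ℂ)) (by simpa using hw)
  simpa using h

lemma exists_isExtInterp {Ω : Set ℂ} (f : Ω → ℂ) {k : ℕ} (X : Matrix (Fin k) (Fin k) ℂ) :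
    ∃ P : ℂ[X], IsExtInterp f X P := by
  classical
  set S := (Matrix.finite_spectrum X).toFinset
  obtain ⟨P, hP⟩ := Ideal.exists_forall_sub_mem_ideal
    (I := fun w : S => Ideal.span {(Polynomial.X - C (w : ℂ)) ^ ((minpoly ℂ X).rootMultiplicity (w : ℂ))})
    (by
      intro i j hij
      simp only [Function.onFun]
      rw [Ideal.isCoprime_span_singleton_iff]
      exact (isCoprime_X_sub_C_of_isUnit_sub (sub_ne_zero.2 fun h => hij (Subtype.ext h)).isUnit).pow)
    (fun w : S => if hw : (w : ℂ) ∈ Ω then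
      ∑ s ∈ Finset.range ((minpoly ℂ X).rootMultiplicity (w : ℂ)),
        C (tDeriv f s ⟨w, hw⟩ / (s.factorial : ℂ)) * (Polynomial.X - C (w : ℂ)) ^ s else 0)
  have hmain : ∀ w : Ω, (minpoly ℂ X).IsRoot (w : ℂ) →
      ∀ s < (minpoly ℂ X).rootMultiplicity (w : ℂ),
      (derivative^[s] P).eval (w : ℂ) = tDeriv f s w := by
    intro w hw s hs
    have h1 := hP ⟨(w : ℂ), by simpa [S] using (isRoot_minpoly_iff X w).1 hw⟩
    rw [dif_pos w.2, Ideal.mem_span_singleton] at h1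
    obtain ⟨R, hR⟩ := h1
    have h2 : (derivative^[s] ((Polynomial.X - C (w : ℂ)) ^
        ((minpoly ℂ X).rootMultiplicity (w : ℂ)) * R)).eval (w : ℂ) = 0 := by
      have hd := pow_sub_dvd_iterate_derivative_of_pow_dvd s (Dvd.intro R rfl :
        (Polynomial.X - C (w : ℂ)) ^ ((minpoly ℂ X).rootMultiplicity (w : ℂ)) ∣
        (Polynomial.X - C (w : ℂ)) ^ ((minpoly ℂ X).rootMultiplicity (w : ℂ)) * R)
      obtain ⟨Q, hQ⟩ := hd
      rw [hQ]
      simp [show (minpoly ℂ X).rootMultiplicity (w : ℂ) - s ≠ 0 by omega]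
    rw [← hR, iterate_derivative_sub, eval_sub, sub_eq_zero] at h2
    rw [h2, iterate_derivative_sum, eval_finsetSum, Finset.sum_eq_single s]
    · rw [iterate_derivative_C_mul, iterate_derivative_X_sub_pow_self]
      have hf : (s.factorial : ℂ) ≠ 0 := by exact_mod_cast s.factorial_ne_zero
      simp [hf]
    · intro t _ hts
      rw [iterate_derivative_C_mul, iterate_derivative_X_sub_pow]
      rcases Nat.lt_or_ge t s with hlt | hge
      · simp [Nat.descFactorial_of_lt hlt]
      · simp [show t - s ≠ 0 by omega]
    · intro hns
      exact absurd (Finset.mem_range.2 hs) hns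
  refine ⟨P, fun w hw => ⟨fun _ => hmain w hw, fun _ => ?_⟩⟩
  have h0 : 0 < (minpoly ℂ X).rootMultiplicity (w : ℂ) :=
    (rootMultiplicity_pos (minpoly.ne_zero (Algebra.IsIntegral.isIntegral X))).2 hw
  simpa [tDeriv] using hmain w hw 0 h0

lemma IsDiagonalizable.minpoly_dvd {k : ℕ} {X : Matrix (Fin k) (Fin k) ℂ}
    (h : IsDiagonalizable X) :
    minpoly ℂ X ∣ ∏ w ∈ (Matrix.finite_spectrum X).toFinset, (Polynomial.X - C w) := by
  classical
  obtain ⟨P, d, hd⟩ := h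
  set Pi : Matrix (Fin k) (Fin k) ℂ := ((P⁻¹ : (Matrix (Fin k) (Fin k) ℂ)ˣ) :
    Matrix (Fin k) (Fin k) ℂ) with hPi
  have h1 : Pi * (P : Matrix (Fin k) (Fin k) ℂ) = 1 := P.inv_mul
  have h2 : (P : Matrix (Fin k) (Fin k) ℂ) * Pi = 1 := P.mul_inv
  have hX : X = Pi * Matrix.diagonal d * (P : Matrix (Fin k) (Fin k) ℂ) := by
    rw [← hd]
    calc X = 1 * X * 1 := by simp
      _ = _ := by rw [← h1]; simp only [Matrix.mul_assoc]
  have haev : ∀ q : ℂ[X], aeval X q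
      = Pi * Matrix.diagonal (fun i => q.eval (d i)) * (P : Matrix (Fin k) (Fin k) ℂ) := by
    intro q
    induction q using Polynomial.induction_on' with
    | add p q hp hq =>
      rw [map_add, hp, hq, ← Matrix.add_mul, ← Matrix.mul_add, Matrix.diagonal_add]
      simp
    | monomial n a =>
      have hpow : ∀ n : ℕ, X ^ n
          = Pi * Matrix.diagonal (fun i => d i ^ n) * (P : Matrix (Fin k) (Fin k) ℂ) := by
        intro n
        induction n with
        | zero => simp [h1]
        | succ n ihn =>
          rw [pow_succ, ihn]
          rw [hX]
          calc Pi * Matrix.diagonal (fun i => d i ^ n) * (P : Matrix (Fin k) (Fin k) ℂ)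
                * (Pi * Matrix.diagonal d * (P : Matrix (Fin k) (Fin k) ℂ))
              = Pi * Matrix.diagonal (fun i => d i ^ n) * ((P : Matrix (Fin k) (Fin k) ℂ) * Pi)
                * Matrix.diagonal d * (P : Matrix (Fin k) (Fin k) ℂ) := by
                simp only [Matrix.mul_assoc]
            _ = _ := by
                rw [h2, Matrix.mul_one, Matrix.mul_assoc Pi, Matrix.diagonal_mul_diagonal]
                simp only [pow_succ]
      rw [aeval_monomial, hpow, ← Algebra.smul_def, ← Matrix.smul_mul, ← Matrix.mul_smul,
        ← Matrix.diagonal_smul]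
      congr 3
      ext i
      simp
  refine minpoly.dvd ℂ X ?_
  rw [haev]
  have hz : (fun i => (∏ w ∈ (Matrix.finite_spectrum X).toFinset,
      (Polynomial.X - C w)).eval (d i)) = 0 := by
    funext i
    have hmem : d i ∈ spectrum ℂ X := by
      have h3 : spectrum ℂ (Matrix.diagonal d) = spectrum ℂ X := by
        rw [← hd]
        exact spectrum.units_conjugate
      rw [← h3, spectrum_diagonal]
      exact Set.mem_range_self i
    rw [eval_prod]
    exact Finset.prod_eq_zero (i := d i) (by simpa using hmem) (by simp)
  rw [hz]
  simp

lemma IsDiagonalizable.rootMultiplicity_le_one {k : ℕ} {X : Matrix (Fin k) (Fin k) ℂ}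
    (h : IsDiagonalizable X) (w : ℂ) : (minpoly ℂ X).rootMultiplicity w ≤ 1 := by
  classical
  have hne : (∏ w ∈ (Matrix.finite_spectrum X).toFinset, (Polynomial.X - C w)) ≠ 0 :=
    Finset.prod_ne_zero_iff.2 fun w _ => X_sub_C_ne_zero w
  refine (rootMultiplicity_le_rootMultiplicity_of_dvd hne h.minpoly_dvd w).trans ?_
  rw [← count_roots, roots_prod_X_sub_C]
  exact Multiset.nodup_iff_count_le_one.1 (Finset.nodup _) w

lemma diagMat_subset_extMat (Ω : Set ℂ) (k : ℕ) : diagMat Ω k ⊆ extMat Ω k := by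
  rintro X ⟨hX, hd⟩
  refine ⟨hX, fun w hw => ?_⟩
  have := hd.rootMultiplicity_le_one w
  omega

/-- Two polynomials satisfying the same interpolation conditions take the same value at `X`. -/
lemma aeval_eq_of_isExtInterp {Ω : Set ℂ} {f : Ω → ℂ} {k : ℕ} {X : Matrix (Fin k) (Fin k) ℂ}
    (hX : X ∈ extMat Ω k) {P Q : ℂ[X]} (hP : IsExtInterp f X P) (hQ : IsExtInterp f X Q) :
    aeval X P = aeval X Q := by
  have hm : minpoly ℂ X ≠ 0 := minpoly.ne_zero (Algebra.IsIntegral.isIntegral X)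
  rw [← sub_eq_zero, ← map_sub, ← minpoly.dvd_iff]
  by_cases h0 : P - Q = 0
  · rw [h0]; exact dvd_zero _
  rw [(IsAlgClosed.splits (minpoly ℂ X)).dvd_iff_roots_le_roots hm h0, Multiset.le_iff_count]
  intro w
  rw [count_roots, count_roots]
  by_cases hw : (minpoly ℂ X).IsRoot w
  · have hwΩ : w ∈ Ω := hX.1 ((isRoot_minpoly_iff X w).1 hw)
    obtain ⟨hP1, hP2⟩ := hP ⟨w, hwΩ⟩ hw
    obtain ⟨hQ1, hQ2⟩ := hQ ⟨w, hwΩ⟩ hw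
    by_cases hc : (⟨w, hwΩ⟩ : Ω) ∈ clusterPts Ω
    · have hpos := (rootMultiplicity_pos hm).2 hw
      have := lt_rootMultiplicity_of_isRoot_iterate_derivative
        (n := (minpoly ℂ X).rootMultiplicity w - 1) (t := w) h0 (by
          intro s hs
          rw [IsRoot, iterate_derivative_sub, eval_sub, sub_eq_zero]
          exact (hP1 hc s (by simp only; omega)).trans (hQ1 hc s (by simp only; omega)).symm)
      omega
    · have h1 : (minpoly ℂ X).rootMultiplicity w ≤ 1 := by
        by_contra hlt
        obtain ⟨_, h'⟩ := hX.2 w (by omega)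
        exact hc h'
      have h2 : 0 < (P - Q).rootMultiplicity w := by
        rw [rootMultiplicity_pos h0, IsRoot, eval_sub, sub_eq_zero]
        exact (hP2 hc).trans (hQ2 hc).symm
      omega
  · rw [rootMultiplicity_eq_zero hw]
    exact Nat.zero_le _

/-- For diagonalizable `X` the two interpolation conditions coincide. -/
lemma isExtInterp_iff_isInterp {Ω : Set ℂ} (f : Ω → ℂ) {k : ℕ} {X : Matrix (Fin k) (Fin k) ℂ}
    (hX : IsDiagonalizable X) (P : ℂ[X]) : IsExtInterp f X P ↔ IsInterp f X P := by
  have hm : minpoly ℂ X ≠ 0 := minpoly.ne_zero (Algebra.IsIntegral.isIntegral X)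
  constructor
  · intro h w hw
    have hr := (isRoot_minpoly_iff X w).2 hw
    by_cases hc : w ∈ clusterPts Ω
    · simpa [tDeriv] using (h w hr).1 hc 0 ((rootMultiplicity_pos hm).2 hr)
    · exact (h w hr).2 hc
  · intro h w hr
    have hv := h w ((isRoot_minpoly_iff X w).1 hr)
    refine ⟨fun _ s hs => ?_, fun _ => hv⟩
    have := hX.rootMultiplicity_le_one (w : ℂ)
    obtain rfl : s = 0 := by omega
    simpa [tDeriv] using hv

/-! ### The functional calculi -/

/-- `f_op` on `D_k(Ω)`: `f[X] = W[X]` for any polynomial `W` that agrees with `f` on the spectrum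
of `X`. -/
noncomputable def fOpDiag {Ω : Set ℂ} (f : Ω → ℂ) (k : ℕ) (X : diagMat Ω k) :
    Matrix (Fin k) (Fin k) ℂ :=
  aeval (X : Matrix (Fin k) (Fin k) ℂ) (exists_isInterp f (X : Matrix (Fin k) (Fin k) ℂ)).choose

/-- `f_op` on `M_k^o(Ω)` (meant for `f` of class `TC^{k-1}`): `f[X] = P[X]` for any polynomial `P`
satisfying the conditions `IsExtInterp f X P`. -/
noncomputable def fOp {Ω : Set ℂ} (f : Ω → ℂ) (k : ℕ) (X : extMat Ω k) :
    Matrix (Fin k) (Fin k) ℂ :=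
  aeval (X : Matrix (Fin k) (Fin k) ℂ)
    (exists_isExtInterp f (X : Matrix (Fin k) (Fin k) ℂ)).choose

/-- The value `f[X]` does not depend on the choice of the polynomial. -/
lemma fOp_eq {Ω : Set ℂ} (f : Ω → ℂ) (k : ℕ) (X : extMat Ω k) (P : ℂ[X])
    (hP : IsExtInterp f (X : Matrix (Fin k) (Fin k) ℂ) P) :
    fOp f k X = aeval (X : Matrix (Fin k) (Fin k) ℂ) P := by
  exact aeval_eq_of_isExtInterp X.2
    (exists_isExtInterp f (X : Matrix (Fin k) (Fin k) ℂ)).choose_spec hP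

/-- The value `f[X]`, for diagonalizable `X`, does not depend on the choice of the polynomial. -/
lemma fOpDiag_eq {Ω : Set ℂ} (f : Ω → ℂ) (k : ℕ) (X : diagMat Ω k) (W : ℂ[X])
    (hW : IsInterp f (X : Matrix (Fin k) (Fin k) ℂ) W) :
    fOpDiag f k X = aeval (X : Matrix (Fin k) (Fin k) ℂ) W := by
  exact aeval_eq_of_isExtInterp (f := f) (diagMat_subset_extMat Ω k X.2)
    ((isExtInterp_iff_isInterp f X.2.2 _).2
      (exists_isInterp f (X : Matrix (Fin k) (Fin k) ℂ)).choose_spec)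
    ((isExtInterp_iff_isInterp f X.2.2 _).2 hW)

/-- On `D_k(Ω)` the extended calculus is the original one. -/
lemma fOp_inclusion {Ω : Set ℂ} (f : Ω → ℂ) (k : ℕ) (X : diagMat Ω k) :
    fOp f k (Set.inclusion (diagMat_subset_extMat Ω k) X) = fOpDiag f k X := by
  refine fOp_eq f k _ _ ((isExtInterp_iff_isInterp f X.2.2 _).2 ?_)
  exact (exists_isInterp f (X : Matrix (Fin k) (Fin k) ℂ)).choose_spec

end MatCalc

namespace MatCalc

/-! ### Divided differences, bidiagonal matrices and interpolating polynomials -/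

section Algebra

variable {Ω : Set ℂ}

/-! Write `k = m + 1`. The link between matrices and divided differences is the bidiagonal matrix
`B(z)` with diagonal `z` and ones above it. If the entries of `z` are distinct, `B(z)` is
diagonalizable and the corner entry of `f[B(z)]` is the divided difference of `f` at `z`. As `z →
(a, …, a)`, `B(z)` tends to a Jordan block, which lies in `M_k^o(Ω)` when `a ∈ Ω'`. A continuous
extension of the calculus therefore forces the divided differences to converge, which is (i) ⇒ (iii)
(`isDDC_of_continuous_extension`).

For (iii) ⇒ (ii), convergence in order `m` implies convergence in all lower orders
(`IsDDC.of_succ`), and then at every tuple, not only at constant ones (`IsDDC.exists_tendsto`). So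
divided differences extend continuously to the closure of the injective tuples, which contains each
tuple whose repeated entries lie in `Ω'` (`mem_closure_injTuples`). The Newton polynomials built
from the extended differences depend continuously on the nodes. Identities valid for distinct nodes
pass to the closure by density. With nodes `(a, …, a, x)` they give the Taylor expansions of class
`TC^m`; with general nodes they give Hermite interpolation, so `f[Y] = N_z[Y]` whenever the minimal
polynomial of `Y` divides the nodal polynomial of `z`. When `Y → A`, the roots of the minimal
polynomials converge along ultrafilters to nodes of a polynomial annihilating `A`
(`exists_tendsto_roots_minpoly`), and `N_z[Y]` converges with them.

(ii) ⇒ (i) holds because the two calculi agree on diagonalizable matrices. -/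

lemma exists_interpolant (f : Ω → ℂ) (n : ℕ) {z : Fin n → Ω} (hz : Function.Injective z) :
    ∃ P : ℂ[X], P.degree < n ∧ ∀ i, P.eval (z i : ℂ) = f (z i) := by
  have hinj : Set.InjOn (fun i => (z i : ℂ)) (Finset.univ : Finset (Fin n)) :=
    (Subtype.val_injective.comp hz).injOn
  refine ⟨Lagrange.interpolate Finset.univ (fun i => (z i : ℂ)) (fun i => f (z i)), ?_, fun i => ?_⟩
  · simpa using Lagrange.degree_interpolate_lt (fun i => f (z i)) hinj
  · exact Lagrange.eval_interpolate_at_node _ hinj (Finset.mem_univ i)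

lemma interpolant_unique {n : ℕ} {z : Fin n → Ω} (hz : Function.Injective z) {P Q : ℂ[X]}
    (hP : P.degree < n) (hQ : Q.degree < n) (h : ∀ i, P.eval (z i : ℂ) = Q.eval (z i : ℂ)) :
    P = Q := by
  refine Polynomial.eq_of_degrees_lt_of_eval_index_eq (s := Finset.univ)
    (v := fun i => (z i : ℂ)) (Subtype.val_injective.comp hz).injOn ?_ ?_ (fun i _ => h i)
  · simpa using hP
  · simpa using hQ

/-- The divided difference is the leading coefficient of the interpolating polynomial. -/
lemma dividedDiff_eq_coeff (f : Ω → ℂ) (n : ℕ) {z : Fin (n + 1) → Ω} (hz : Function.Injective z)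
    {P : ℂ[X]} (hP : P.degree < (n + 1 : ℕ)) (h : ∀ i, P.eval (z i : ℂ) = f (z i)) :
    dividedDiff f n z = P.coeff n := by
  induction n generalizing P with
  | zero =>
    rw [Polynomial.eq_C_of_degree_le_zero (p := P)
      (Nat.WithBot.lt_one_iff_le_zero.1 (by simpa using hP))] at h ⊢
    simpa [dividedDiff] using (h 0).symm
  | succ n ih =>
    have h1 : Function.Injective fun i : Fin (n + 1) => z i.succ :=
      hz.comp (Fin.succ_injective _)
    have h0 : Function.Injective fun i : Fin (n + 1) => z i.castSucc :=
      hz.comp (Fin.castSucc_injective _)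
    obtain ⟨P1, hd1, hP1⟩ := exists_interpolant f (n + 1) h1
    obtain ⟨P0, hd0, hP0⟩ := exists_interpolant f (n + 1) h0
    have hne : ((z (Fin.last (n + 1)) : ℂ) - (z 0 : ℂ)) ≠ 0 := by
      refine sub_ne_zero.2 fun hh => ?_
      exact absurd (hz (Subtype.ext hh)) (Fin.last_pos.ne')
    -- Aitken–Neville: the interpolant at all nodes is glued from the interpolants omitting the
    -- first and the last node.
    have hQ : P = C (((z (Fin.last (n + 1)) : ℂ) - (z 0 : ℂ))⁻¹) *
        ((X - C (z 0 : ℂ)) * P1 - (X - C (z (Fin.last (n + 1)) : ℂ)) * P0) := by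
      have hdeg : ∀ (c : ℂ) (Q : ℂ[X]), Q.degree < (n + 1 : ℕ) →
          ((X - C c) * Q).degree < ((n + 1 + 1 : ℕ) : WithBot ℕ) := by
        intro c Q hQ
        rw [degree_mul, degree_X_sub_C, add_comm]
        rcases eq_or_ne Q 0 with rfl | hQ0
        · simp
        · rw [degree_eq_natDegree hQ0] at hQ ⊢
          exact_mod_cast Nat.add_lt_add_right (by exact_mod_cast hQ) 1
      refine interpolant_unique hz hP ?_ fun i => ?_
      · refine (degree_C_mul (inv_ne_zero hne)).trans_lt ((degree_sub_le _ _).trans_lt ?_)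
        exact max_lt (hdeg _ _ hd1) (hdeg _ _ hd0)
      · rw [h i]
        simp only [eval_mul, eval_sub, eval_X, eval_C]
        rw [eq_inv_mul_iff_mul_eq₀ hne]
        induction i using Fin.cases with
        | zero =>
          have := hP0 0
          simp only [Fin.castSucc_zero] at this
          rw [this]; ring
        | succ i =>
          rw [hP1 i]
          induction i using Fin.lastCases with
          | last => simp
          | cast i =>
            have := hP0 i.succ
            rw [← Fin.succ_castSucc] at this
            rw [this]; ring
    have e : ∀ (c : ℂ) (Q : ℂ[X]), Q.degree < (n + 1 : ℕ) →
        ((X - C c) * Q).coeff (n + 1) = Q.coeff n := by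
      intro c Q hQ
      rw [sub_mul, coeff_sub, coeff_X_mul, coeff_C_mul, coeff_eq_zero_of_degree_lt hQ]
      simp
    rw [hQ, coeff_C_mul, coeff_sub, e _ _ hd1, e _ _ hd0, dividedDiff, ih h1 hd1 hP1,
      ih h0 hd0 hP0, div_eq_inv_mul]

/-- The interpolating polynomial does not see the order of the nodes. -/
lemma dividedDiff_comp_perm (f : Ω → ℂ) (n : ℕ) {z : Fin (n + 1) → Ω}
    (hz : Function.Injective z) (σ : Equiv.Perm (Fin (n + 1))) :
    dividedDiff f n (z ∘ σ) = dividedDiff f n z := by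
  obtain ⟨P, hd, hP⟩ := exists_interpolant f (n + 1) hz
  rw [dividedDiff_eq_coeff f n hz hd hP,
    dividedDiff_eq_coeff f n (hz.comp σ.injective) hd fun i => hP (σ i)]

/-- The upper bidiagonal matrix with diagonal `z` and ones above the diagonal. -/
def bidiag {n : ℕ} (z : Fin n → ℂ) : Matrix (Fin n) (Fin n) ℂ :=
  Matrix.of fun i j => if i = j then z i else if (j : ℕ) = i + 1 then 1 else 0

lemma bidiag_blockTriangular {n : ℕ} (z : Fin n → ℂ) : (bidiag z).BlockTriangular id := by
  intro i j hij
  have hij' : j < i := hij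
  have : (j : ℕ) < i := hij'
  simp only [bidiag, Matrix.of_apply]
  rw [if_neg hij'.ne', if_neg (by omega)]

lemma charpoly_bidiag {n : ℕ} (z : Fin n → ℂ) :
    (bidiag z).charpoly = ∏ i, (X - C (z i)) := by
  rw [Matrix.charpoly_of_isUpperTriangular _ (bidiag_blockTriangular z)]
  simp [bidiag]

lemma spectrum_bidiag {n : ℕ} (z : Fin n → ℂ) : spectrum ℂ (bidiag z) = Set.range z := by
  ext w
  rw [Matrix.mem_spectrum_iff_isRoot_charpoly, charpoly_bidiag, IsRoot, eval_prod,
    Finset.prod_eq_zero_iff]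
  simp [sub_eq_zero, eq_comm]

/-- Entry `(0, j)` of the `i`-th power is a weighted count of paths of length `i` from `0` to `j`
whose steps stay or advance by one. None exists for `i < j`, and exactly one, of weight `1`, for `i
= j`. -/
lemma bidiag_pow_apply_zero {n : ℕ} (z : Fin (n + 1) → ℂ) (i : ℕ) (j : Fin (n + 1)) :
    (i < j → (bidiag z ^ i) 0 j = 0) ∧ (i = j → (bidiag z ^ i) 0 j = 1) := by
  induction i generalizing j with
  | zero =>
    refine ⟨fun h => ?_, fun h => ?_⟩
    · rw [pow_zero, Matrix.one_apply_ne]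
      rintro rfl
      simp at h
    · obtain rfl : j = 0 := Fin.ext h.symm
      simp
  | succ i ih =>
    have hle : i + 1 ≤ j → ∃ l : Fin (n + 1), (l : ℕ) + 1 = j ∧ (bidiag z ^ (i + 1)) 0 j
        = (bidiag z ^ i) 0 l := by
      intro h
      refine ⟨⟨j - 1, by omega⟩, by simp only; omega, ?_⟩
      rw [pow_succ, Matrix.mul_apply, Finset.sum_eq_single (⟨j - 1, by omega⟩ : Fin (n + 1))]
      · have h1 : (⟨j - 1, by omega⟩ : Fin (n + 1)) ≠ j := by
          intro h'
          have := congrArg Fin.val h'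
          simp only at this
          omega
        simp only [bidiag, Matrix.of_apply]
        rw [if_neg h1, if_pos (by omega), mul_one]
      · intro b _ hb
        by_cases hbj : b = j
        · rw [(ih b).1 (by rw [hbj]; omega), zero_mul]
        · simp only [bidiag, Matrix.of_apply]
          rw [if_neg hbj, if_neg, mul_zero]
          intro h'
          exact hb (Fin.ext (by simp only; omega))
      · simp
    refine ⟨fun h => ?_, fun h => ?_⟩
    · obtain ⟨l, hl, e⟩ := hle h.le
      rw [e]
      exact (ih l).1 (by omega)
    · obtain ⟨l, hl, e⟩ := hle h.le
      rw [e]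
      exact (ih l).2 (by omega)

/-- The corner entry of `P[B]`, for a bidiagonal matrix `B`, is the leading coefficient of the
Hermite interpolation polynomial of `P` at the diagonal entries. -/
lemma aeval_bidiag_apply {n : ℕ} (z : Fin (n + 1) → ℂ) (P : ℂ[X]) :
    (aeval (bidiag z) P) 0 (Fin.last n) = (P %ₘ ∏ i, (X - C (z i))).coeff n := by
  have hm : (∏ i, (X - C (z i))).Monic := monic_prod_of_monic _ _ fun i _ => monic_X_sub_C _
  have h0 : aeval (bidiag z) (∏ i, (X - C (z i))) = 0 := by
    rw [← charpoly_bidiag]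
    exact Matrix.aeval_self_charpoly _
  -- By Cayley–Hamilton `P` may be replaced by its remainder modulo the characteristic polynomial;
  -- among the powers below `n + 1` only the `n`-th reaches the corner.
  conv_lhs => rw [← modByMonic_add_div P (∏ i, (X - C (z i)))]
  rw [map_add, map_mul, h0, zero_mul, add_zero]
  set R := P %ₘ ∏ i, (X - C (z i))
  have hR : R.natDegree < n + 1 := by
    have hd : (∏ i, (X - C (z i))).natDegree = n + 1 := by simp
    have := natDegree_modByMonic_lt P hm (by intro h; rw [h] at hd; simp at hd)
    rwa [hd] at this
  rw [aeval_eq_sum_range' hR, Matrix.sum_apply, Finset.sum_range_succ, Finset.sum_eq_zero]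
  · simp [(bidiag_pow_apply_zero z n (Fin.last n)).2 (by simp)]
  · intro i hi
    simp [(bidiag_pow_apply_zero z i (Fin.last n)).1 (by simpa using hi)]

/-- For distinct nodes, the remainder of `P` modulo the nodal polynomial is the interpolant of `f`.
-/
lemma aeval_bidiag_eq_dividedDiff {n : ℕ} {z : Fin (n + 1) → Ω} (hz : Function.Injective z)
    {f : Ω → ℂ} {P : ℂ[X]} (hP : ∀ i, P.eval (z i : ℂ) = f (z i)) :
    (aeval (bidiag fun i => (z i : ℂ)) P) 0 (Fin.last n) = dividedDiff f n z := by
  have hm : (∏ i, (X - C (z i : ℂ))).Monic := monic_prod_of_monic _ _ fun i _ => monic_X_sub_C _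
  rw [aeval_bidiag_apply, dividedDiff_eq_coeff f n hz]
  · have := degree_modByMonic_lt P hm
    rw [degree_prod_of_monic _ _ fun i _ => monic_X_sub_C _] at this
    simpa using this
  · intro i
    rw [← hP i]
    conv_rhs => rw [← modByMonic_add_div P (∏ i, (X - C (z i : ℂ)))]
    have h0 : ∏ j, eval (z i : ℂ) (X - C (z j : ℂ)) = 0 :=
      Finset.prod_eq_zero (Finset.mem_univ i) (by simp)
    rw [eval_add, eval_mul, eval_prod, h0, zero_mul, add_zero]

/-- Reduction modulo `(X - a)^(n+1)` keeps the `n`-th derivative at `a`, and that of a polynomial of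
degree at most `n` is `n!` times its coefficient of order `n`. -/
lemma aeval_bidiag_const {n : ℕ} (a : ℂ) (P : ℂ[X]) :
    (n.factorial : ℂ) * (aeval (bidiag fun _ : Fin (n + 1) => a) P) 0 (Fin.last n)
      = (derivative^[n] P).eval a := by
  rw [aeval_bidiag_apply]
  simp only [Finset.prod_const, Finset.card_univ, Fintype.card_fin]
  have hm : ((X - C a) ^ (n + 1)).Monic := (monic_X_sub_C a).pow _
  conv_rhs => rw [← modByMonic_add_div P ((X - C a) ^ (n + 1))]
  set R := P %ₘ (X - C a) ^ (n + 1)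
  have hR : R.natDegree ≤ n := by
    have hd : ((X - C a) ^ (n + 1)).natDegree = n + 1 := by simp
    have := natDegree_modByMonic_lt P hm (by intro h; rw [h] at hd; simp at hd)
    rw [hd] at this
    exact Nat.lt_succ_iff.1 this
  obtain ⟨Q, hQ⟩ := pow_sub_dvd_iterate_derivative_of_pow_dvd n
    (Dvd.intro (P /ₘ (X - C a) ^ (n + 1)) rfl :
      (X - C a) ^ (n + 1) ∣ (X - C a) ^ (n + 1) * (P /ₘ (X - C a) ^ (n + 1)))
  have hRc : derivative^[n] R = C ((derivative^[n] R).coeff 0) := by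
    refine eq_C_of_natDegree_le_zero ((natDegree_iterate_derivative R n).trans ?_)
    omega
  rw [iterate_map_add, eval_add, hQ, hRc, coeff_iterate_derivative]
  simp [Nat.descFactorial_self]

end Algebra

/-! ### Limits of divided differences at tuples with repeated entries -/

section Limits

variable {Ω : Set ℂ}

lemma mem_clusterPts_iff {a : Ω} : a ∈ clusterPts Ω ↔ (𝓝[≠] a).NeBot := by
  rw [← mem_closure_iff_nhdsWithin_neBot, closure_subtype]
  have : (Subtype.val : Ω → ℂ) '' {a}ᶜ = Ω \ {(a : ℂ)} := by
    ext w
    constructor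
    · rintro ⟨v, hv, rfl⟩
      exact ⟨v.2, fun h => hv (Subtype.ext h)⟩
    · rintro ⟨hw, hw'⟩
      exact ⟨⟨w, hw⟩, fun h => hw' (congrArg Subtype.val h), rfl⟩
  rw [this]
  rfl

lemma nhds_eq_pure_of_notMem_clusterPts {a : Ω} (ha : a ∉ clusterPts Ω) : 𝓝 a = pure a := by
  rw [mem_clusterPts_iff, not_neBot] at ha
  rw [← nhdsNE_sup_pure, ha, bot_sup_eq]

/-- The tuples with pairwise distinct entries. -/
def injTuples (Ω : Set ℂ) (n : ℕ) : Set (Fin n → Ω) := {v | Function.Injective v}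

/-- The tail is perturbed first, then the head. A head in `Ω'` has infinitely many points nearby, so
it can avoid the finitely many tail entries. A head outside `Ω'` is isolated and stays fixed, but
then it differs from all tail entries, and so do small perturbations of these. -/
lemma mem_closure_injTuples {n : ℕ} {z : Fin n → Ω}
    (h : ∀ i j, i ≠ j → z i = z j → z i ∈ clusterPts Ω) : z ∈ closure (injTuples Ω n) := by
  induction n with
  | zero => exact subset_closure (Function.injective_of_subsingleton _)
  | succ n ih =>
    have hw : ∃ᶠ w in 𝓝 (Fin.tail z), w ∈ injTuples Ω n := by
      rw [← mem_closure_iff_frequently]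
      refine ih fun i j hij hz => ?_
      exact h i.succ j.succ (by simpa using hij) hz
    have hw2 : ∃ᶠ w in 𝓝 (Fin.tail z), ∃ᶠ y in 𝓝 (z 0),
        (Fin.cons y w : Fin (n + 1) → Ω) ∈ injTuples Ω (n + 1) := by
      by_cases h0 : z 0 ∈ clusterPts Ω
      · refine hw.mono fun w hw => ?_
        have := mem_clusterPts_iff.1 h0
        rw [frequently_iff]
        intro U hU
        obtain ⟨y, hyU, hy⟩ := ((infinite_of_mem_nhds _ hU).sdiff (Set.finite_range w)).nonempty
        exact ⟨y, hyU, Fin.cons_injective_iff.2 ⟨hy, hw⟩⟩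
      · have he : ∀ᶠ w in 𝓝 (Fin.tail z), ∀ i, w i ≠ z 0 := by
          rw [eventually_all]
          intro i
          refine (continuous_apply i).continuousAt.eventually_ne ?_
          intro hi
          exact h0 (hi ▸ h i.succ 0 (Fin.succ_ne_zero i) hi)
        refine (hw.and_eventually he).mono fun w hw => ?_
        rw [nhds_eq_pure_of_notMem_clusterPts h0, frequently_pure]
        exact Fin.cons_injective_iff.2 ⟨by rintro ⟨i, hi⟩; exact hw.2 i hi, hw.1⟩
    -- The head is chosen after the tail, which is frequency for the curried filter; this is finer
    -- than the product filter.
    have hcurry : ∃ᶠ p in 𝓝 (Fin.tail z) ×ˢ 𝓝 (z 0),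
        (Fin.cons p.2 p.1 : Fin (n + 1) → Ω) ∈ injTuples Ω (n + 1) :=
      ((frequently_curry_iff _).2 hw2).filter_mono curry_le_prod
    rw [mem_closure_iff_frequently]
    have ht : Tendsto (fun p : (Fin n → Ω) × Ω => (Fin.cons p.2 p.1 : Fin (n + 1) → Ω))
        (𝓝 (Fin.tail z) ×ˢ 𝓝 (z 0)) (𝓝 z) := by
      rw [tendsto_pi_nhds]
      intro i
      induction i using Fin.cases with
      | zero => simpa using tendsto_snd
      | succ i =>
        simp only [Fin.cons_succ]
        exact ((continuous_apply i).tendsto (Fin.tail z)).comp tendsto_fst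
    exact ht.frequently hcurry

lemma const_mem_closure_injTuples {a : Ω} (ha : a ∈ clusterPts Ω) (n : ℕ) :
    (fun _ : Fin n => a) ∈ closure (injTuples Ω n) :=
  mem_closure_injTuples fun _ _ _ _ => ha

lemma tendsto_comp_injTuples {m n : ℕ} {e : Fin m → Fin n} (he : Function.Injective e)
    (z : Fin n → Ω) :
    Tendsto (fun v : Fin n → Ω => v ∘ e) (𝓝[injTuples Ω n] z) (𝓝[injTuples Ω m] (z ∘ e)) := by
  refine tendsto_nhdsWithin_iff.2 ⟨?_, ?_⟩
  · have : Continuous fun v : Fin n → Ω => v ∘ e := by fun_prop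
    exact (this.tendsto z).mono_left nhdsWithin_le_nhds
  · filter_upwards [self_mem_nhdsWithin] with v hv
    exact Function.Injective.comp hv he

lemma mapsTo_comp_closure_injTuples {m n : ℕ} {e : Fin m → Fin n} (he : Function.Injective e) :
    Set.MapsTo (fun v : Fin n → Ω => v ∘ e) (closure (injTuples Ω n))
      (closure (injTuples Ω m)) := by
  have hc : Continuous fun v : Fin n → Ω => v ∘ e := by fun_prop
  refine Set.MapsTo.closure ?_ hc
  exact fun v hv => Function.Injective.comp hv he

/-- Consecutive windows of a sequence have close divided differences, if the divided differences
of the next order are bounded. -/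
lemma norm_dividedDiff_window_sub_le {f : Ω → ℂ} {n : ℕ} {a : Ω} {r C : ℝ} (hC : 0 ≤ C)
    (hb : ∀ v ∈ injTuples Ω (n + 2), (∀ i, dist (v i) a < r) → ‖dividedDiff f (n + 1) v‖ ≤ C)
    {u : ℕ → Ω} {M : ℕ} (hu : Set.InjOn u (Set.Iio M)) (hur : ∀ i < M, dist (u i) a < r)
    (N : ℕ) (hN : N + n < M) :
    ‖dividedDiff f n (fun i => u (N + i)) - dividedDiff f n (fun i => u i)‖
      ≤ N * (2 * r * C) := by
  induction N with
  | zero => simp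
  | succ N ih =>
    have hinj : (fun i : Fin (n + 2) => u (N + i)) ∈ injTuples Ω (n + 2) := by
      intro i j hij
      have := hu (by simp only [Set.mem_Iio]; omega) (by simp only [Set.mem_Iio]; omega) hij
      exact Fin.ext (by omega)
    have h1 := hb _ hinj fun i => hur _ (by omega)
    have hne : ((u (N + (n + 1)) : ℂ) - (u N : ℂ)) ≠ 0 := by
      refine sub_ne_zero.2 fun hh => ?_
      have := hu (by simp only [Set.mem_Iio]; omega) (by simp only [Set.mem_Iio]; omega)
        (Subtype.ext hh)
      omega
    -- By the recursion, a shift by one changes the difference by the next-order difference times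
    -- the distance vector of its end nodes.
    have h2 : dividedDiff f n (fun i => u (N + 1 + i)) - dividedDiff f n (fun i => u (N + i))
        = dividedDiff f (n + 1) (fun i => u (N + i)) * ((u (N + (n + 1)) : ℂ) - (u N : ℂ)) := by
      simp only [dividedDiff, Fin.val_last, Fin.val_zero, add_zero, Fin.val_succ, Fin.val_castSucc]
      rw [div_mul_cancel₀ _ hne]
      simp only [add_assoc, add_comm 1]
    have h3 : ‖(u (N + (n + 1)) : ℂ) - (u N : ℂ)‖ ≤ 2 * r := by
      rw [← dist_eq_norm]
      have ha := hur (N + (n + 1)) (by omega)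
      have hb := hur N (by omega)
      have := dist_triangle_right (u (N + (n + 1))) (u N) a
      rw [Subtype.dist_eq (u (N + (n + 1))) (u N)] at this
      linarith
    calc _ = ‖(dividedDiff f n (fun i => u (N + 1 + i)) - dividedDiff f n (fun i => u (N + i)))
          + (dividedDiff f n (fun i => u (N + i)) - dividedDiff f n (fun i => u i))‖ := by
          rw [sub_add_sub_cancel]
      _ ≤ C * (2 * r) + N * (2 * r * C) := by
          refine (norm_add_le _ _).trans (add_le_add ?_ (ih (by omega)))
          rw [h2, norm_mul]
          gcongr
      _ = _ := by push_cast; ring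

/-- Put `w` after `z` to get one sequence of `2(n+1)` distinct points and slide the window from `z`
to `w` in `n + 1` shifts, each costing at most `2rC`. -/
lemma norm_dividedDiff_sub_le {f : Ω → ℂ} {n : ℕ} {a : Ω} {r C : ℝ} (hC : 0 ≤ C)
    (hb : ∀ v ∈ injTuples Ω (n + 2), (∀ i, dist (v i) a < r) → ‖dividedDiff f (n + 1) v‖ ≤ C)
    {z w : Fin (n + 1) → Ω} (hz : Function.Injective z) (hw : Function.Injective w)
    (hzw : ∀ i j, z i ≠ w j) (hzr : ∀ i, dist (z i) a < r) (hwr : ∀ i, dist (w i) a < r) :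
    ‖dividedDiff f n w - dividedDiff f n z‖ ≤ (n + 1) * (2 * r * C) := by
  -- The default value `a` is only taken at indices from `2(n+1)` on, outside the range used.
  set u : ℕ → Ω := fun i => if h : i < n + 1 then z ⟨i, h⟩ else
    if h : i - (n + 1) < n + 1 then w ⟨i - (n + 1), h⟩ else a with hu
  have h := norm_dividedDiff_window_sub_le (u := u) (M := 2 * (n + 1)) hC hb ?_ ?_ (n + 1) (by omega)
  · have e1 : (fun i : Fin (n + 1) => u (n + 1 + i)) = w := by
      funext i
      have h1 : n + 1 + (i : ℕ) - (n + 1) = i := by omega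
      simp only [hu]
      rw [dif_neg (by omega), dif_pos (by omega)]
      exact congrArg w (Fin.ext h1)
    have e2 : (fun i : Fin (n + 1) => u i) = z := by
      funext i
      exact dif_pos i.2
    rw [e1, e2] at h
    exact_mod_cast h
  · intro i hi j hj hij
    simp only [Set.mem_Iio] at hi hj
    simp only [hu] at hij
    split_ifs at hij with h1 h2 h3 h4 h5 <;> try omega
    · simpa using hz hij
    · exact absurd hij (hzw _ _)
    · exact absurd hij.symm (hzw _ _)
    · have := hw hij
      simp only [Fin.mk.injEq] at this
      omega
  · intro i hi
    simp only [hu]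
    split_ifs with h1 h2
    · exact hzr _
    · exact hwr _
    · omega

/-- The differences of order `n + 1` are bounded near `(a, …, a)`, so those of order `n` at disjoint
tuples within `r` of `a` differ by `O(r)`. Tuples that share points are compared through a third one
disjoint from both, and the Cauchy criterion applies. -/
lemma IsDDC.of_succ {f : Ω → ℂ} {n : ℕ} (hf : IsDDC f (n + 1)) : IsDDC f n := by
  intro a ha
  obtain ⟨L, hL⟩ := hf a ha
  have hne : (𝓝[injTuples Ω (n + 1)] (fun _ : Fin (n + 1) => a)).NeBot :=
    mem_closure_iff_nhdsWithin_neBot.1 (const_mem_closure_injTuples ha _)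
  change ∃ L, Tendsto (dividedDiff f n) (𝓝[injTuples Ω (n + 1)] (fun _ : Fin (n + 1) => a)) (𝓝 L)
  rw [← cauchy_map_iff_exists_tendsto, Metric.cauchy_iff]
  refine ⟨inferInstance, fun ε hε => ?_⟩
  set C : ℝ := ‖L‖ + 1
  have hC : 0 < C := by positivity
  have hbd : ∀ᶠ v in 𝓝[injTuples Ω (n + 2)] (fun _ : Fin (n + 2) => a),
      ‖dividedDiff f (n + 1) v‖ ≤ C :=
    hL.norm.eventually_le_const (lt_add_one _)
  obtain ⟨δ, hδ, hball⟩ := Metric.mem_nhdsWithin_iff.1 hbd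
  have hb : ∀ v ∈ injTuples Ω (n + 2), (∀ i, dist (v i) a < δ) →
      ‖dividedDiff f (n + 1) v‖ ≤ C := fun v hv hva =>
    hball ⟨Metric.mem_ball.2 ((dist_pi_lt_iff hδ).2 hva), hv⟩
  set K : ℝ := (n + 1) * (2 * C)
  have hK : 0 < K := by positivity
  -- Each of the two comparisons costs at most `K * r ≤ ε / 4`.
  set r : ℝ := min δ (ε / (4 * K))
  have hr : 0 < r := by positivity
  have hrδ : r ≤ δ := min_le_left _ _
  have hrK : K * r ≤ ε / 4 := by
    calc K * r ≤ K * (ε / (4 * K)) := by gcongr; exact min_le_right _ _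
      _ = ε / 4 := by field_simp
  have hb' : ∀ v ∈ injTuples Ω (n + 2), (∀ i, dist (v i) a < r) →
      ‖dividedDiff f (n + 1) v‖ ≤ C := fun v hv hva => hb v hv fun i => (hva i).trans_le hrδ
  refine ⟨dividedDiff f n '' (Metric.ball (fun _ => a) r ∩ injTuples Ω (n + 1)),
    image_mem_map (Metric.mem_nhdsWithin_iff.2 ⟨r, hr, subset_rfl⟩), ?_⟩
  rintro _ ⟨z, ⟨hzr, hz⟩, rfl⟩ _ ⟨w, ⟨hwr, hw⟩, rfl⟩
  rw [Metric.mem_ball, dist_pi_lt_iff hr] at hzr hwr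
  have := mem_clusterPts_iff.1 ha
  -- Since `a` is a cluster point, enough points remain near `a` for a tuple avoiding both `z` and
  -- `w`.
  have hinf : (Metric.ball a r \ (Set.range z ∪ Set.range w)).Infinite :=
    (infinite_of_mem_nhds _ (Metric.ball_mem_nhds a hr)).sdiff
      ((Set.finite_range z).union (Set.finite_range w))
  set y : Fin (n + 1) → Ω := fun i => (hinf.natEmbedding _ i : Ω)
  have hy : Function.Injective y :=
    Subtype.val_injective.comp ((hinf.natEmbedding _).injective.comp Fin.val_injective)
  have hym : ∀ i, y i ∈ Metric.ball a r \ (Set.range z ∪ Set.range w) :=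
    fun i => (hinf.natEmbedding _ i).2
  have h1 := norm_dividedDiff_sub_le hC.le hb' hy hz
    (fun i j h => (hym i).2 (Or.inl ⟨j, h.symm⟩)) (fun i => (hym i).1) hzr
  have h2 := norm_dividedDiff_sub_le hC.le hb' hy hw
    (fun i j h => (hym i).2 (Or.inr ⟨j, h.symm⟩)) (fun i => (hym i).1) hwr
  have e : ((n : ℝ) + 1) * (2 * r * C) = K * r := by simp only [K]; ring
  rw [e, ← dist_eq_norm] at h1 h2
  have := dist_triangle_right (dividedDiff f n z) (dividedDiff f n w) (dividedDiff f n y)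
  linarith

lemma IsDDC.of_le {f : Ω → ℂ} {m n : ℕ} (hf : IsDDC f m) (h : n ≤ m) : IsDDC f n := by
  induction m, h using Nat.le_induction with
  | base => exact hf
  | succ m _ ih => exact ih hf.of_succ

/-- `IsDDC` speaks of `Ω'` only; a constant tuple at any other point is isolated, so there is
nothing to prove there. -/
lemma IsDDC.exists_tendsto_of_const {f : Ω → ℂ} {n : ℕ} (hf : IsDDC f n) {z : Fin (n + 1) → Ω}
    (hz : ∀ i, z i = z 0) :
    ∃ L, Tendsto (dividedDiff f n) (𝓝[injTuples Ω (n + 1)] z) (𝓝 L) := by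
  by_cases h0 : z 0 ∈ clusterPts Ω
  · rw [funext hz]
    exact hf (z 0) h0
  · have hpure : 𝓝 z = pure z := by
      rw [nhds_pi, ← Filter.pi_pure]
      congr 1
      funext i
      rw [hz]
      exact nhds_eq_pure_of_notMem_clusterPts h0
    exact ⟨_, (tendsto_pure_nhds _ z).mono_left (nhdsWithin_le_nhds.trans hpure.le)⟩

/-- Induction on the order. If some `z i` differs from `z 0`, symmetry lets `i` be moved to the last
place; the denominator of the recursion then has a nonzero limit, and the numerator converges by
induction. -/
lemma IsDDC.exists_tendsto {f : Ω → ℂ} {n : ℕ} (hf : IsDDC f n) (z : Fin (n + 1) → Ω) :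
    ∃ L, Tendsto (dividedDiff f n) (𝓝[injTuples Ω (n + 1)] z) (𝓝 L) := by
  induction n with
  | zero => exact hf.exists_tendsto_of_const fun i => congrArg z (Fin.ext (by simp))
  | succ n ih =>
    by_cases hconst : ∀ i, z i = z 0
    · exact hf.exists_tendsto_of_const hconst
    · push Not at hconst
      obtain ⟨i, hi⟩ := hconst
      have hi0 : i ≠ 0 := by rintro rfl; exact hi rfl
      set σ : Equiv.Perm (Fin (n + 2)) := Equiv.swap i (Fin.last (n + 1))
      have hσ0 : σ 0 = 0 := Equiv.swap_apply_of_ne_of_ne hi0.symm Fin.last_pos.ne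
      have hσl : σ (Fin.last (n + 1)) = i := Equiv.swap_apply_right _ _
      have hσ : Function.Injective σ := σ.injective
      obtain ⟨L1, h1⟩ := ih hf.of_succ ((z ∘ σ) ∘ Fin.succ)
      obtain ⟨L0, h0⟩ := ih hf.of_succ ((z ∘ σ) ∘ Fin.castSucc)
      have t1 := h1.comp ((tendsto_comp_injTuples (Fin.succ_injective _) (z ∘ σ)).comp
        (tendsto_comp_injTuples hσ z))
      have t0 := h0.comp ((tendsto_comp_injTuples (Fin.castSucc_injective _) (z ∘ σ)).comp
        (tendsto_comp_injTuples hσ z))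
      have td : Tendsto (fun v : Fin (n + 2) → Ω => (v i : ℂ) - (v 0 : ℂ))
          (𝓝[injTuples Ω (n + 2)] z) (𝓝 ((z i : ℂ) - (z 0 : ℂ))) := by
        have hc : Continuous fun v : Fin (n + 2) → Ω => (v i : ℂ) - (v 0 : ℂ) := by fun_prop
        exact (hc.tendsto z).mono_left nhdsWithin_le_nhds
      refine ⟨_, ((t1.sub t0).div td
        (sub_ne_zero.2 fun h => hi (Subtype.ext h))).congr' ?_⟩
      filter_upwards [self_mem_nhdsWithin] with v hv
      rw [← dividedDiff_comp_perm f (n + 1) hv σ]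
      simp only [dividedDiff, Function.comp_apply, hσ0, hσl]
      rfl

/-- The divided difference, extended by continuity to tuples with repeated entries. -/
noncomputable def dividedDiffExt (f : Ω → ℂ) (n : ℕ) : (Fin (n + 1) → Ω) → ℂ :=
  extendFrom (injTuples Ω (n + 1)) (dividedDiff f n)

lemma IsDDC.continuousOn_dividedDiffExt {f : Ω → ℂ} {n : ℕ} (hf : IsDDC f n) :
    ContinuousOn (dividedDiffExt f n) (closure (injTuples Ω (n + 1))) :=
  continuousOn_extendFrom subset_rfl fun z _ => hf.exists_tendsto z

/-- The point lies in the set along which the limit is taken, so the limit must be the value. -/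
lemma IsDDC.dividedDiffExt_eq {f : Ω → ℂ} {n : ℕ} (hf : IsDDC f n) {z : Fin (n + 1) → Ω}
    (hz : Function.Injective z) : dividedDiffExt f n z = dividedDiff f n z := by
  obtain ⟨L, hL⟩ := hf.exists_tendsto z
  have hz' : z ∈ injTuples Ω (n + 1) := hz
  have h1 : Tendsto (dividedDiff f n) (pure z) (𝓝 L) := hL.mono_left (pure_le_nhdsWithin hz')
  have h2 : dividedDiff f n z = L := tendsto_nhds_unique (tendsto_pure_nhds _ z) h1
  rw [h2]
  exact extendFrom_eq (subset_closure hz') hL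

end Limits

/-! ### Newton polynomials with continuously varying nodes -/

section Newton

variable {Ω : Set ℂ}

/-- The polynomial in Newton form with nodes `z` and coefficients `φ j (z 0, …, z j)`. -/
noncomputable def newtonPoly (φ : (n : ℕ) → (Fin (n + 1) → Ω) → ℂ) :
    (n : ℕ) → (Fin n → Ω) → ℂ[X]
  | 0, _ => 0
  | n + 1, z => newtonPoly φ n (z ∘ Fin.castSucc) +
      C (φ n z) * ∏ i : Fin n, (X - C (z i.castSucc : ℂ))

lemma degree_newtonPoly_lt (φ : (n : ℕ) → (Fin (n + 1) → Ω) → ℂ) (n : ℕ) (z : Fin n → Ω) :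
    (newtonPoly φ n z).degree < n := by
  induction n with
  | zero => simp [newtonPoly]
  | succ n ih =>
    have hn : ((n : ℕ) : WithBot ℕ) < ((n + 1 : ℕ) : WithBot ℕ) := by exact_mod_cast n.lt_succ_self
    refine (degree_add_le _ _).trans_lt (max_lt ((ih _).trans hn) ?_)
    rw [C_mul']
    refine (degree_smul_le _ _).trans_lt ?_
    rw [degree_prod_of_monic _ _ fun i _ => monic_X_sub_C _]
    simpa using hn

/-- Removing the top Newton term from the full interpolant keeps its values at the first `n` nodes
and kills its coefficient of order `n`. What remains is the interpolant at those nodes. Only the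
values of `φ` at injective tuples matter, so extended differences are allowed. -/
lemma eval_newtonPoly {f : Ω → ℂ} {n : ℕ} {φ : (n : ℕ) → (Fin (n + 1) → Ω) → ℂ}
    (hφ : ∀ j < n, ∀ v ∈ injTuples Ω (j + 1), φ j v = dividedDiff f j v)
    {z : Fin n → Ω} (hz : Function.Injective z) (i : Fin n) :
    (newtonPoly φ n z).eval (z i : ℂ) = f (z i) := by
  induction n with
  | zero => exact i.elim0
  | succ n ih =>
    obtain ⟨P, hd, hP⟩ := exists_interpolant f (n + 1) hz
    have hz0 : Function.Injective (z ∘ Fin.castSucc) := hz.comp (Fin.castSucc_injective _)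
    have hm : (∏ i : Fin n, (X - C (z i.castSucc : ℂ))).Monic :=
      monic_prod_of_monic _ _ fun i _ => monic_X_sub_C _
    have hdm : (∏ i : Fin n, (X - C (z i.castSucc : ℂ))).natDegree = n := by simp
    have hPN : P - C (φ n z) * ∏ i : Fin n, (X - C (z i.castSucc : ℂ))
        = newtonPoly φ n (z ∘ Fin.castSucc) := by
      refine interpolant_unique hz0 ?_ (degree_newtonPoly_lt _ _ _) fun i => ?_
      · rw [degree_lt_iff_coeff_zero]
        intro k hk
        rw [coeff_sub, coeff_C_mul]
        rcases hk.eq_or_lt with rfl | hk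
        · have h1 := hm.coeff_natDegree
          rw [hdm] at h1
          rw [h1, hφ n n.lt_succ_self z hz, dividedDiff_eq_coeff f n hz hd hP]
          ring
        · rw [coeff_eq_zero_of_degree_lt (hd.trans_le (by exact_mod_cast hk)),
            coeff_eq_zero_of_natDegree_lt (by rwa [hdm])]
          ring
      · rw [ih (fun j hj => hφ j (by omega)) hz0 i, eval_sub, eval_mul, eval_prod,
          Finset.prod_eq_zero (Finset.mem_univ i) (by simp), mul_zero, sub_zero]
        exact hP i.castSucc
    rw [newtonPoly, ← hPN, sub_add_cancel, hP]

lemma continuous_coeff_prod_X_sub_C {T ι : Type*} [TopologicalSpace T] (s : Finset ι)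
    {g : ι → T → ℂ} (hg : ∀ i, Continuous (g i)) (k : ℕ) :
    Continuous fun t => (∏ i ∈ s, (X - C (g i t))).coeff k := by
  classical
  induction s using Finset.induction_on generalizing k with
  | empty => simpa using continuous_const
  | insert i s hi ih =>
    simp only [Finset.prod_insert hi, sub_mul, coeff_sub, coeff_C_mul]
    refine Continuous.sub ?_ ((hg i).mul (ih k))
    cases k with
    | zero => simpa using continuous_const
    | succ k => simpa only [coeff_X_mul] using ih k

/-- The uniform degree bound turns evaluation into a sum of fixed length, jointly continuous in the
coefficients and the matrix. -/
lemma tendsto_aeval_of_tendsto_coeff {ι : Type*} {l : Filter ι} {n k : ℕ} {P : ι → ℂ[X]}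
    {Q : ℂ[X]} {Y : ι → Matrix (Fin k) (Fin k) ℂ} {X : Matrix (Fin k) (Fin k) ℂ}
    (hP : ∀ t, (P t).degree < n) (hQ : Q.degree < n)
    (hc : ∀ i, Tendsto (fun t => (P t).coeff i) l (𝓝 (Q.coeff i))) (hY : Tendsto Y l (𝓝 X)) :
    Tendsto (fun t => aeval (Y t) (P t)) l (𝓝 (aeval X Q)) := by
  have hd : ∀ {R : ℂ[X]}, R.degree < n → R.natDegree < n + 1 := fun h =>
    Nat.lt_succ_iff.2 (natDegree_le_of_degree_le h.le)
  rw [aeval_eq_sum_range' (hd hQ)]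
  simp only [fun t => aeval_eq_sum_range' (hd (hP t)) (Y t)]
  exact tendsto_finsetSum _ fun i _ => (hc i).smul (hY.pow i)

lemma continuousOn_coeff_newtonPoly {φ : (n : ℕ) → (Fin (n + 1) → Ω) → ℂ} {n : ℕ}
    (hφ : ∀ j < n, ContinuousOn (φ j) (closure (injTuples Ω (j + 1)))) (k : ℕ) :
    ContinuousOn (fun z => (newtonPoly φ n z).coeff k) (closure (injTuples Ω n)) := by
  induction n with
  | zero => simpa [newtonPoly] using continuousOn_const
  | succ n ih =>
    simp only [newtonPoly, coeff_add, coeff_C_mul]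
    refine ContinuousOn.add ?_ ((hφ n n.lt_succ_self).mul ?_)
    · have hc : Continuous fun v : Fin (n + 1) → Ω => v ∘ Fin.castSucc := by fun_prop
      exact (ih fun j hj => hφ j (by omega)).comp hc.continuousOn
        (mapsTo_comp_closure_injTuples (Fin.castSucc_injective n))
    · exact (continuous_coeff_prod_X_sub_C Finset.univ (fun i => by fun_prop) k).continuousOn

lemma continuous_bidiag {n : ℕ} : Continuous (bidiag : (Fin n → ℂ) → _) := by
  refine continuous_matrix fun i j => ?_
  simp only [bidiag, Matrix.of_apply]
  split_ifs <;> fun_prop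

/-! ### Taylor expansions and Hermite interpolation by density of distinct nodes -/

variable {f : Ω → ℂ}

/-- Every 1-tuple is injective, so `f` is its own extended difference of order zero. -/
lemma IsDDC.continuous (hf : IsDDC f 0) : Continuous f := by
  have hinj : ∀ z : Fin 1 → Ω, z ∈ injTuples Ω 1 := fun z => Function.injective_of_subsingleton z
  have h : f = fun x => dividedDiffExt f 0 fun _ => x := by
    funext x
    rw [hf.dividedDiffExt_eq (hinj _)]
    rfl
  rw [h]
  refine hf.continuousOn_dividedDiffExt.comp_continuous (by fun_prop) fun x => ?_
  exact subset_closure (hinj _)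

/-- Both sides are continuous on the closure and agree at distinct nodes. -/
lemma IsDDC.eval_newtonPoly_ext {m n : ℕ} (hf : IsDDC f m) (hn : n ≤ m + 1) {z : Fin n → Ω}
    (hz : z ∈ closure (injTuples Ω n)) (i : Fin n) :
    (newtonPoly (dividedDiffExt f) n z).eval (z i : ℂ) = f (z i) := by
  have hfj : ∀ j < n, IsDDC f j := fun j hj => hf.of_le (by omega)
  have hEq : Set.EqOn (fun z : Fin n → Ω => (newtonPoly (dividedDiffExt f) n z).eval (z i : ℂ))
      (fun z => f (z i)) (injTuples Ω n) := fun z hz =>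
    eval_newtonPoly (fun j hj v hv => (hfj j hj).dividedDiffExt_eq hv) hz i
  have hfc : Continuous f := (hf.of_le (Nat.zero_le _)).continuous
  refine hEq.of_subset_closure ?_ (by fun_prop) subset_closure subset_rfl hz
  have hd : ∀ z : Fin n → Ω, (newtonPoly (dividedDiffExt f) n z).natDegree < n + 1 := fun z =>
    Nat.lt_succ_iff.2 (natDegree_le_of_degree_le (degree_newtonPoly_lt _ _ _).le)
  simp only [fun z : Fin n → Ω => eval_eq_sum_range' (hd z) (z i : ℂ)]
  refine continuousOn_finsetSum _ fun k _ => ?_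
  refine (continuousOn_coeff_newtonPoly (fun j hj => (hfj j hj).continuousOn_dividedDiffExt)
    k).mul ?_
  fun_prop

/-- The same density argument for a subtuple of the nodes. When the subtuple collapses to one point,
the corner entry becomes a derivative of the Newton polynomial, which is how the Hermite conditions
are reached. -/
lemma IsDDC.aeval_bidiag_newtonPoly {m n s : ℕ} (hf : IsDDC f m) (hn : n ≤ m + 1) (hs : s ≤ m)
    {e : Fin (s + 1) → Fin n} (he : Function.Injective e) {z : Fin n → Ω}
    (hz : z ∈ closure (injTuples Ω n)) :
    (aeval (bidiag fun i => (z (e i) : ℂ)) (newtonPoly (dividedDiffExt f) n z)) 0 (Fin.last s)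
      = dividedDiffExt f s (z ∘ e) := by
  have hfj : ∀ j < n, IsDDC f j := fun j hj => hf.of_le (by omega)
  have hEq : Set.EqOn (fun z : Fin n → Ω =>
      (aeval (bidiag fun i => (z (e i) : ℂ)) (newtonPoly (dividedDiffExt f) n z)) 0 (Fin.last s))
      (fun z => dividedDiffExt f s (z ∘ e)) (injTuples Ω n) := by
    intro z hz
    have hze : Function.Injective (z ∘ e) := Function.Injective.comp hz he
    simp only
    rw [(hf.of_le hs).dividedDiffExt_eq hze]
    exact aeval_bidiag_eq_dividedDiff hze fun i =>
      eval_newtonPoly (fun j hj v hv => (hfj j hj).dividedDiffExt_eq hv) hz (e i)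
  refine hEq.of_subset_closure ?_ ?_ subset_closure subset_rfl hz
  · intro z hz
    have hY : Continuous fun z : Fin n → Ω => bidiag fun i => (z (e i) : ℂ) :=
      continuous_bidiag.comp (by fun_prop)
    have := tendsto_aeval_of_tendsto_coeff (l := 𝓝[closure (injTuples Ω n)] z)
      (fun z => degree_newtonPoly_lt (dividedDiffExt f) n z) (degree_newtonPoly_lt _ _ z)
      (fun i => continuousOn_coeff_newtonPoly
        (fun j hj => (hfj j hj).continuousOn_dividedDiffExt) i z hz)
      ((hY.tendsto z).mono_left nhdsWithin_le_nhds)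
    exact ((continuous_apply_apply 0 (Fin.last s)).tendsto _).comp this
  · have hc : Continuous fun v : Fin n → Ω => v ∘ e := by fun_prop
    exact (hf.of_le hs).continuousOn_dividedDiffExt.comp hc.continuousOn
      (mapsTo_comp_closure_injTuples he)

lemma newtonPoly_const (φ : (n : ℕ) → (Fin (n + 1) → Ω) → ℂ) (n : ℕ) (a : Ω) :
    newtonPoly φ n (fun _ => a)
      = ∑ j ∈ Finset.range n, C (φ j fun _ => a) * (X - C (a : ℂ)) ^ j := by
  induction n with
  | zero => simp [newtonPoly]
  | succ n ih =>
    rw [Finset.sum_range_succ, ← ih, newtonPoly]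
    simp [Function.comp_def]

lemma snoc_mem_closure_injTuples {a : Ω} (ha : a ∈ clusterPts Ω) (n : ℕ) (x : Ω) :
    (Fin.snoc (fun _ : Fin n => a) x : Fin (n + 1) → Ω) ∈ closure (injTuples Ω (n + 1)) := by
  refine mem_closure_injTuples fun i j hij h => ?_
  induction i using Fin.lastCases with
  | last =>
    induction j using Fin.lastCases with
    | last => exact absurd rfl hij
    | cast j =>
      rw [h, Fin.snoc_castSucc]
      exact ha
  | cast i =>
    rw [Fin.snoc_castSucc]
    exact ha

lemma snoc_const_self {a : Ω} (n : ℕ) :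
    (Fin.snoc (fun _ : Fin n => a) a : Fin (n + 1) → Ω) = fun _ => a := by
  funext i
  induction i using Fin.lastCases with
  | last => simp
  | cast i => simp

lemma continuous_snoc_const (n : ℕ) : Continuous fun p : clusterPts Ω × Ω =>
    (Fin.snoc (fun _ : Fin n => (p.1 : Ω)) p.2 : Fin (n + 1) → Ω) := by
  refine continuous_pi fun i => ?_
  induction i using Fin.lastCases with
  | last => simpa using continuous_snd
  | cast i =>
    simp only [Fin.snoc_castSucc]
    exact continuous_subtype_val.comp continuous_fst

lemma IsDDC.continuous_dividedDiffExt_snoc {n : ℕ} (hf : IsDDC f n) :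
    Continuous fun p : clusterPts Ω × Ω =>
      dividedDiffExt f n (Fin.snoc (fun _ : Fin n => (p.1 : Ω)) p.2) :=
  hf.continuousOn_dividedDiffExt.comp_continuous (continuous_snoc_const n) fun p =>
    snoc_mem_closure_injTuples p.1.2 n p.2

lemma IsDDC.continuous_dividedDiffExt_const {n : ℕ} (hf : IsDDC f n) :
    Continuous fun a : clusterPts Ω => dividedDiffExt f n fun _ => (a : Ω) :=
  hf.continuousOn_dividedDiffExt.comp_continuous (by fun_prop) fun a =>
    const_mem_closure_injTuples a.2 _

/-- This is Newton interpolation at the nodes `(a, …, a, x)`, evaluated at `x`. The last coefficient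
`Δ(a, …, a, x)` splits into `Δ(a, …, a)`, the top Taylor coefficient, and the remainder. -/
lemma IsDDC.isTaylor {n : ℕ} (hf : IsDDC f n) {a : Ω} (ha : a ∈ clusterPts Ω) :
    IsTaylor f n a (fun j => j.factorial * dividedDiffExt f j fun _ => a)
      (fun x => dividedDiffExt f n (Fin.snoc (fun _ : Fin n => a) x)
        - dividedDiffExt f n fun _ => a) := by
  refine ⟨fun x => ?_, ?_, ?_⟩
  · have h := hf.eval_newtonPoly_ext le_rfl (snoc_mem_closure_injTuples ha n x) (Fin.last n)
    rw [Fin.snoc_last] at h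
    have hc : (Fin.snoc (fun _ : Fin n => a) x : Fin (n + 1) → Ω) ∘ Fin.castSucc = fun _ => a := by
      funext i
      simp
    have hfac : ∀ j : ℕ, (j.factorial : ℂ) ≠ 0 := fun j => by exact_mod_cast j.factorial_ne_zero
    rw [← h, newtonPoly, hc, newtonPoly_const, Finset.sum_range_succ]
    simp only [Fin.snoc_castSucc, Finset.prod_const, Finset.card_univ, Fintype.card_fin, eval_add,
      eval_mul, eval_finsetSum, eval_C, eval_pow, eval_sub, eval_X, mul_div_cancel_left₀ _ (hfac _)]
    ring
  · simp [snoc_const_self]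
  · have h1 : Continuous fun x : Ω => ((⟨a, ha⟩ : clusterPts Ω), x) := by fun_prop
    exact ((hf.continuous_dividedDiffExt_snoc.comp h1).sub continuous_const).continuousAt

lemma IsDDC.tDeriv_eq {m j : ℕ} (hf : IsDDC f m) (hj : j ≤ m) {a : Ω} (ha : a ∈ clusterPts Ω) :
    tDeriv f j a = j.factorial * dividedDiffExt f j fun _ => a :=
  (hf.isTaylor ha).tDeriv_eq ha j hj

lemma IsDDC.isTC {n : ℕ} (hf : IsDDC f n) : IsTC f n := by
  cases n with
  | zero => exact hf.continuous
  | succ n =>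
    refine ⟨_, _, fun a => hf.isTaylor a.2, fun j _ hj => ?_, ?_⟩
    · exact continuous_const.mul (hf.of_le hj).continuous_dividedDiffExt_const
    · exact hf.continuous_dividedDiffExt_snoc.sub
        (hf.continuous_dividedDiffExt_const.comp continuous_fst)

lemma rootMultiplicity_prod_X_sub_C {n : ℕ} (z : Fin n → ℂ) (w : ℂ) :
    (∏ i, (X - C (z i))).rootMultiplicity w = (Finset.univ.filter fun i => z i = w).card := by
  classical
  rw [← count_roots]
  have : ∏ i, (X - C (z i)) = ((Finset.univ.val.map z).map fun a => X - C a).prod := by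
    rw [Multiset.map_map]
    rfl
  rw [this, roots_multiset_prod_X_sub_C, Multiset.count_map]
  simp only [Finset.card_def, Finset.filter_val, eq_comm]

/-- The multiplicity provides `s + 1` nodes equal to `a`. At this constant subtuple the corner entry
is both the `s`-th derivative over `s!` and the extended difference that defines the T-derivative.
-/
lemma IsDDC.iterate_derivative_eval_newtonPoly {m n s : ℕ} (hf : IsDDC f m) (hn : n ≤ m + 1)
    {z : Fin n → Ω} (hz : z ∈ closure (injTuples Ω n)) {a : Ω} (ha : a ∈ clusterPts Ω)
    (hs : s < (∏ i, (X - C (z i : ℂ))).rootMultiplicity (a : ℂ)) :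
    (derivative^[s] (newtonPoly (dividedDiffExt f) n z)).eval (a : ℂ) = tDeriv f s a := by
  rw [rootMultiplicity_prod_X_sub_C fun i => (z i : ℂ)] at hs
  set e := Finset.orderEmbOfCardLe _ (Nat.succ_le_of_lt hs)
  have hsn : s < n := hs.trans_le ((Finset.card_le_univ _).trans (by simp))
  have hze : z ∘ e = fun _ => a := by
    funext i
    have := Finset.orderEmbOfCardLe_mem _ (Nat.succ_le_of_lt hs) i
    exact Subtype.ext (Finset.mem_filter.1 this).2
  have h := hf.aeval_bidiag_newtonPoly hn (by omega) e.injective hz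
  have hze' : (fun i => (z (e i) : ℂ)) = fun _ => (a : ℂ) := by
    funext i
    exact congrArg Subtype.val (congrFun hze i)
  rw [hze, hze'] at h
  rw [← aeval_bidiag_const, h, hf.tDeriv_eq (by omega) ha]

/-- Divisibility, rather than equality, is needed for limits of matrices, where the degree of the
minimal polynomial may drop. -/
lemma IsDDC.isExtInterp_newtonPoly {m n k : ℕ} (hf : IsDDC f m) (hn : n ≤ m + 1)
    {z : Fin n → Ω} (hz : z ∈ closure (injTuples Ω n)) {Y : Matrix (Fin k) (Fin k) ℂ}
    (hY : minpoly ℂ Y ∣ ∏ i, (X - C (z i : ℂ))) :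
    IsExtInterp f Y (newtonPoly (dividedDiffExt f) n z) := by
  intro w hw
  refine ⟨fun hc s hs => ?_, fun _ => ?_⟩
  · refine hf.iterate_derivative_eval_newtonPoly hn hz hc (hs.trans_le ?_)
    exact rootMultiplicity_le_rootMultiplicity_of_dvd
      (monic_prod_of_monic _ _ fun i _ => monic_X_sub_C _).ne_zero hY _
  · have h0 := hw.dvd hY
    rw [IsRoot, eval_prod, Finset.prod_eq_zero_iff] at h0
    obtain ⟨i, -, hi⟩ := h0
    have hi' : w = z i := by
      simpa [sub_eq_zero, Subtype.ext_iff] using hi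
    rw [hi']
    exact hf.eval_newtonPoly_ext hn hz i

end Newton

/-! ### Convergence of spectra and continuity of the functional calculus -/

section Calculus

variable {Ω : Set ℂ} {f : Ω → ℂ}

/-- A crude Gershgorin bound, used to keep the roots of nearby minimal polynomials in a compact set.
-/
lemma norm_le_sum_of_mem_spectrum {k : ℕ} {Y : Matrix (Fin k) (Fin k) ℂ} {w : ℂ}
    (hw : w ∈ spectrum ℂ Y) : ‖w‖ ≤ ∑ i, ∑ j, ‖Y i j‖ := by
  rw [← Matrix.spectrum_toLin', ← Module.End.hasEigenvalue_iff_mem_spectrum] at hw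
  obtain ⟨i, hi⟩ := eigenvalue_mem_ball hw
  rw [mem_closedBall_iff_norm] at hi
  calc ‖w‖ = ‖Y i i + (w - Y i i)‖ := by rw [add_sub_cancel]
    _ ≤ ‖Y i i‖ + ∑ j ∈ Finset.univ.erase i, ‖Y i j‖ := (norm_add_le _ _).trans (by gcongr)
    _ = ∑ j, ‖Y i j‖ := Finset.add_sum_erase _ (fun j => ‖Y i j‖) (Finset.mem_univ i)
    _ ≤ ∑ i, ∑ j, ‖Y i j‖ := Finset.single_le_sum (f := fun i => ∑ j, ‖Y i j‖)
        (fun i _ => Finset.sum_nonneg fun j _ => norm_nonneg _) (Finset.mem_univ i)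

/-- The roots of the minimal polynomial of a matrix in `extMat Ω k`, listed with multiplicity. -/
lemma exists_minpoly_eq_prod {k d : ℕ} {Y : Matrix (Fin k) (Fin k) ℂ} (hY : Y ∈ extMat Ω k)
    (hd : (minpoly ℂ Y).natDegree = d) : ∃ z : Fin d → Ω,
      z ∈ closure (injTuples Ω d) ∧ minpoly ℂ Y = ∏ i, (X - C (z i : ℂ)) := by
  have hsp := IsAlgClosed.splits (minpoly ℂ Y)
  have hmon : (minpoly ℂ Y).Monic := minpoly.monic (Algebra.IsIntegral.isIntegral Y)
  have hcard : (minpoly ℂ Y).roots.toList.length = d := by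
    rw [Multiset.length_toList, ← hd, hsp.natDegree_eq_card_roots]
  subst hcard
  set l := (minpoly ℂ Y).roots.toList
  have hprod : minpoly ℂ Y = ∏ i : Fin l.length, (X - C (l.get i)) := by
    conv_lhs => rw [hsp.eq_prod_roots_of_monic hmon, ← Multiset.coe_toList (minpoly ℂ Y).roots]
    rw [Multiset.map_coe, Multiset.prod_coe]
    change (l.map fun x => X - C x).prod = _
    conv_lhs => rw [← List.ofFn_get l, List.map_ofFn, List.prod_ofFn]
    rfl
  have hmem : ∀ i, l.get i ∈ Ω := by
    intro i
    refine hY.1 ((isRoot_minpoly_iff Y _).1 ?_)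
    rw [hprod, IsRoot, eval_prod]
    exact Finset.prod_eq_zero (Finset.mem_univ i) (by simp)
  -- A value listed twice is a multiple root, hence in `Ω'`.
  refine ⟨fun i => ⟨l.get i, hmem i⟩, mem_closure_injTuples fun i j hij h => ?_, hprod⟩
  obtain ⟨_, h'⟩ := hY.2 (l.get i) (by
    rw [hprod, rootMultiplicity_prod_X_sub_C]
    refine Finset.one_lt_card.2 ⟨i, by simp, j, ?_, hij⟩
    simpa using (congrArg Subtype.val h).symm)
  exact h'

lemma IsDDC.fOp_eq_aeval_newtonPoly {m n k : ℕ} (hf : IsDDC f m) (hn : n ≤ m + 1)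
    {z : Fin n → Ω} (hz : z ∈ closure (injTuples Ω n)) (Y : extMat Ω k)
    (hY : minpoly ℂ (Y : Matrix (Fin k) (Fin k) ℂ) ∣ ∏ i, (X - C (z i : ℂ))) :
    fOp f k Y = aeval (Y : Matrix (Fin k) (Fin k) ℂ) (newtonPoly (dividedDiffExt f) n z) :=
  fOp_eq f k Y _ (hf.isExtInterp_newtonPoly hn hz hY)

lemma natDegree_minpoly_le {k : ℕ} (Y : Matrix (Fin k) (Fin k) ℂ) :
    (minpoly ℂ Y).natDegree ≤ k := by
  have := natDegree_le_of_dvd (Matrix.minpoly_dvd_charpoly Y) Y.charpoly_monic.ne_zero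
  simpa [Matrix.charpoly_natDegree_eq_dim] using this

/-- Along an ultrafilter of matrices of `extMat Ω k` that converges to a matrix of this set, the
roots of the minimal polynomials converge to roots of an annihilating polynomial of the limit. -/
lemma exists_tendsto_roots_minpoly {k : ℕ} (A : extMat Ω k) (U : Ultrafilter (extMat Ω k))
    (hU : (U : Filter (extMat Ω k)) ≤ 𝓝 A) :
    ∃ d ≤ k, ∃ (z : extMat Ω k → Fin d → Ω) (z' : Fin d → Ω), Tendsto z U (𝓝 z') ∧
      (∀ᶠ Y : extMat Ω k in (U : Filter (extMat Ω k)), z Y ∈ closure (injTuples Ω d) ∧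
        minpoly ℂ (Y : Matrix (Fin k) (Fin k) ℂ) = ∏ i, (X - C (z Y i : ℂ))) ∧
      minpoly ℂ (A : Matrix (Fin k) (Fin k) ℂ) ∣ ∏ i, (X - C (z' i : ℂ)) := by
  have hval : Tendsto (fun Y : extMat Ω k => (Y : Matrix (Fin k) (Fin k) ℂ)) U
      (𝓝 (A : Matrix (Fin k) (Fin k) ℂ)) := (continuous_subtype_val.tendsto A).mono_left hU
  have hdeg : ∀ᶠ Y : extMat Ω k in (U : Filter (extMat Ω k)), ∃ d ∈ Set.Iic k,
      (minpoly ℂ (Y : Matrix (Fin k) (Fin k) ℂ)).natDegree = d :=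
    Eventually.of_forall fun Y => ⟨_, natDegree_minpoly_le _, rfl⟩
  -- The degree takes finitely many values, so it is constant along the ultrafilter. The roots can
  -- then be listed in any order: compactness makes each listing converge.
  obtain ⟨d, hd, hdU⟩ := (Ultrafilter.eventually_exists_mem_iff (Set.finite_Iic k)).1 hdeg
  obtain ⟨z, hz⟩ := (hdU.mono fun Y hY => exists_minpoly_eq_prod Y.2 hY).choice
  have hspec : ∀ᶠ Y : extMat Ω k in (U : Filter (extMat Ω k)), ∀ i,
      (z Y i : ℂ) ∈ spectrum ℂ (Y : Matrix (Fin k) (Fin k) ℂ) := by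
    filter_upwards [hz] with Y hY i
    rw [← isRoot_minpoly_iff, hY.2, IsRoot, eval_prod]
    exact Finset.prod_eq_zero (Finset.mem_univ i) (by simp)
  have hcomp : ∃ w : Fin d → ℂ, Tendsto (fun Y i => (z Y i : ℂ)) U (𝓝 w) := by
    have hc : Continuous fun Y : Matrix (Fin k) (Fin k) ℂ => ∑ i, ∑ j, ‖Y i j‖ := by fun_prop
    set c := ∑ i, ∑ j, ‖(A : Matrix (Fin k) (Fin k) ℂ) i j‖ + 1
    have hb : ∀ᶠ Y : extMat Ω k in (U : Filter (extMat Ω k)),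
        ∑ i, ∑ j, ‖(Y : Matrix (Fin k) (Fin k) ℂ) i j‖ ≤ c :=
      ((hc.tendsto _).comp hval).eventually_le_const (lt_add_one _)
    have hK : IsCompact (Set.univ.pi fun _ : Fin d => Metric.closedBall (0 : ℂ) c) :=
      isCompact_univ_pi fun _ => isCompact_closedBall _ _
    obtain ⟨w, -, hw⟩ := hK.ultrafilter_le_nhds' (U.map fun Y i => (z Y i : ℂ)) (by
      rw [Ultrafilter.mem_map]
      filter_upwards [hb, hspec] with Y hY hs i _
      rw [mem_closedBall_zero_iff]
      exact (norm_le_sum_of_mem_spectrum (hs i)).trans hY)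
    exact ⟨w, hw⟩
  obtain ⟨w, hw⟩ := hcomp
  rw [tendsto_pi_nhds] at hw
  -- `Ω` need not be closed; the limits lie in it because they are eigenvalues of `A`.
  have hwA : ∀ i, w i ∈ spectrum ℂ (A : Matrix (Fin k) (Fin k) ℂ) := by
    intro i
    have hdet : ∀ (c : ℂ) (Y : Matrix (Fin k) (Fin k) ℂ),
        c ∈ spectrum ℂ Y ↔ (c • (1 : Matrix (Fin k) (Fin k) ℂ) - Y).det = 0 := by
      intro c Y
      rw [spectrum.mem_iff, Matrix.isUnit_iff_isUnit_det, isUnit_iff_ne_zero, not_not,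
        Algebra.algebraMap_eq_smul_one]
    rw [hdet]
    have hc : Continuous fun p : ℂ × Matrix (Fin k) (Fin k) ℂ =>
        (p.1 • (1 : Matrix (Fin k) (Fin k) ℂ) - p.2).det := by fun_prop
    have ht := (hc.tendsto (w i, (A : Matrix (Fin k) (Fin k) ℂ))).comp ((hw i).prodMk_nhds hval)
    refine tendsto_nhds_unique ht (tendsto_const_nhds.congr' ?_)
    filter_upwards [hspec] with Y hY
    exact ((hdet _ _).1 (hY i)).symm
  have hwΩ : ∀ i, w i ∈ Ω := fun i => A.2.1 (hwA i)
  refine ⟨d, hd, z, fun i => ⟨w i, hwΩ i⟩, ?_, hz, ?_⟩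
  · rw [tendsto_pi_nhds]
    exact fun i => tendsto_subtype_rng.2 (hw i)
  · refine minpoly.dvd ℂ _ ?_
    have hdegP : ∀ v : Fin d → ℂ, (∏ i, (X - C (v i))).degree < ((d + 1 : ℕ) : WithBot ℕ) := by
      intro v
      rw [degree_prod_of_monic _ _ fun i _ => monic_X_sub_C _]
      simp only [degree_X_sub_C, Finset.sum_const, Finset.card_univ, Fintype.card_fin, nsmul_one]
      exact_mod_cast d.lt_succ_self
    -- Pass to the limit in the identity saying that `Y` is annihilated by its minimal polynomial.
    have ht := tendsto_aeval_of_tendsto_coeff (l := (U : Filter (extMat Ω k)))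
      (fun Y => hdegP fun i => (z Y i : ℂ)) (hdegP w)
      (fun j => ((continuous_coeff_prod_X_sub_C Finset.univ (fun i => continuous_apply i)
        j).tendsto w).comp (tendsto_pi_nhds.2 hw)) hval
    refine tendsto_nhds_unique ht (tendsto_const_nhds.congr' ?_)
    filter_upwards [hz] with Y hY
    rw [← hY.2, minpoly.aeval]

/-- Along an ultrafilter, `f[Y]` is the Newton polynomial at the roots for `Y`, evaluated at `Y`;
nodes, coefficients and matrix all converge. At the limit nodes the Newton polynomial still computes
`f[A]`. -/
lemma IsDDC.continuous_fOp {m k : ℕ} (hf : IsDDC f m) (hk : k ≤ m + 1) :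
    Continuous (fOp f k) := by
  rw [continuous_iff_continuousAt]
  intro A
  rw [ContinuousAt, tendsto_iff_ultrafilter]
  intro U hU
  obtain ⟨d, hd, z, z', hzz', hz, hA⟩ := exists_tendsto_roots_minpoly A U hU
  have hz' : z' ∈ closure (injTuples Ω d) :=
    isClosed_closure.mem_of_tendsto hzz' (hz.mono fun Y hY => hY.1)
  have hval : Tendsto (fun Y : extMat Ω k => (Y : Matrix (Fin k) (Fin k) ℂ)) U
      (𝓝 (A : Matrix (Fin k) (Fin k) ℂ)) := (continuous_subtype_val.tendsto A).mono_left hU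
  rw [hf.fOp_eq_aeval_newtonPoly (hd.trans hk) hz' A hA]
  have hlim := tendsto_aeval_of_tendsto_coeff (l := (U : Filter (extMat Ω k)))
    (fun Y => degree_newtonPoly_lt (dividedDiffExt f) d (z Y)) (degree_newtonPoly_lt _ _ z')
    (fun j => (continuousOn_coeff_newtonPoly
      (fun i hi => (hf.of_le (by omega : i ≤ m)).continuousOn_dividedDiffExt) j z' hz').tendsto.comp
      (tendsto_nhdsWithin_iff.2 ⟨hzz', hz.mono fun Y hY => hY.1⟩)) hval
  refine hlim.congr' ?_
  filter_upwards [hz] with Y hY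
  exact (hf.fOp_eq_aeval_newtonPoly (hd.trans hk) hY.1 Y hY.2.dvd).symm

lemma isDiagonalizable_bidiag {n : ℕ} {z : Fin n → ℂ} (hz : Function.Injective z) :
    IsDiagonalizable (bidiag z) := by
  have hev : ∀ i, Module.End.HasEigenvalue (Matrix.toLin' (bidiag z)) (z i) := by
    intro i
    rw [Module.End.hasEigenvalue_iff_mem_spectrum, Matrix.spectrum_toLin', spectrum_bidiag]
    exact Set.mem_range_self i
  choose v hv using fun i => (hev i).exists_hasEigenvector
  have hlin : LinearIndependent ℂ v := Module.End.eigenvectors_linearIndependent' _ z hz v hv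
  set Q : Matrix (Fin n) (Fin n) ℂ := Matrix.of fun i j => v j i
  have hQ : IsUnit Q := Matrix.linearIndependent_cols_iff_isUnit.1 hlin
  obtain ⟨u, hu⟩ := hQ
  -- `IsDiagonalizable` conjugates as `P * X * P⁻¹`, so `P` is the inverse of the eigenvector
  -- matrix.
  refine ⟨u⁻¹, z, ?_⟩
  have hBQ : bidiag z * u = u * Matrix.diagonal z := by
    rw [hu]
    ext i j
    have h := congrFun (hv j).apply_eq_smul i
    rw [Matrix.toLin'_apply] at h
    rw [Matrix.mul_diagonal]
    simpa [Matrix.mul_apply, Matrix.mulVec, dotProduct, Q, mul_comm] using h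
  rw [inv_inv, mul_assoc, hBQ, ← mul_assoc, Units.inv_mul, one_mul]

/-- The divided differences are matrix entries of the functional calculus. -/
lemma isDDC_of_continuous_extension {m : ℕ}
    {g : extMat Ω (m + 1) → Matrix (Fin (m + 1)) (Fin (m + 1)) ℂ} (hg : Continuous g)
    (h : ∀ Y : diagMat Ω (m + 1),
      g (Set.inclusion (diagMat_subset_extMat Ω (m + 1)) Y) = fOpDiag f (m + 1) Y) :
    IsDDC f m := by
  intro a ha
  have hdiag : ∀ v ∈ injTuples Ω (m + 1), bidiag (fun i => (v i : ℂ)) ∈ diagMat Ω (m + 1) := by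
    intro v hv
    refine ⟨?_, isDiagonalizable_bidiag (Subtype.val_injective.comp hv)⟩
    rw [specMat, Set.mem_ofPred_eq, spectrum_bidiag]
    rintro _ ⟨i, rfl⟩
    exact (v i).2
  -- The only eigenvalue of the Jordan block is `a ∈ Ω'`, so its multiple roots are allowed.
  have hjordan : bidiag (fun _ : Fin (m + 1) => (a : ℂ)) ∈ extMat Ω (m + 1) := by
    have hs : ∀ w ∈ spectrum ℂ (bidiag fun _ : Fin (m + 1) => (a : ℂ)), w = a := by
      intro w hw
      rw [spectrum_bidiag] at hw
      obtain ⟨i, rfl⟩ := hw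
      rfl
    refine ⟨fun w hw => hs w hw ▸ a.2, fun w hw => ?_⟩
    have hne := minpoly.ne_zero
      (Algebra.IsIntegral.isIntegral (R := ℂ) (bidiag fun _ : Fin (m + 1) => (a : ℂ)))
    obtain rfl := hs w ((isRoot_minpoly_iff _ _).1 ((rootMultiplicity_pos hne).1 (by omega)))
    exact ⟨a.2, ha⟩
  refine ⟨g ⟨_, hjordan⟩ 0 (Fin.last m), ?_⟩
  change Tendsto _ (𝓝[injTuples Ω (m + 1)] fun _ => a) _
  have hb : Continuous fun v : Fin (m + 1) → Ω => bidiag fun i => (v i : ℂ) :=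
    continuous_bidiag.comp (by fun_prop)
  -- Extension by zero lets the limit be taken in the ambient matrix space, within `extMat`.
  set G : Matrix (Fin (m + 1)) (Fin (m + 1)) ℂ → Matrix (Fin (m + 1)) (Fin (m + 1)) ℂ :=
    Function.extend Subtype.val g 0
  have hGg : ∀ Y : extMat Ω (m + 1), G Y = g Y := fun Y =>
    Subtype.val_injective.extend_apply g 0 Y
  have hG : ContinuousOn G (extMat Ω (m + 1)) := by
    rw [continuousOn_iff_continuous_domRestrict]
    exact hg.congr fun Y => (hGg Y).symm
  have hlim := (hG _ hjordan).tendsto.comp (tendsto_nhdsWithin_iff.2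
    ⟨(hb.tendsto fun _ => a).mono_left (nhdsWithin_le_nhds (s := injTuples Ω (m + 1))), by
      filter_upwards [self_mem_nhdsWithin] with v hv
      exact diagMat_subset_extMat _ _ (hdiag v hv)⟩)
  rw [hGg ⟨_, hjordan⟩] at hlim
  refine (((continuous_apply_apply 0 (Fin.last m)).tendsto _).comp hlim).congr' ?_
  filter_upwards [self_mem_nhdsWithin] with v hv
  obtain ⟨P, -, hP⟩ := exists_interpolant f (m + 1) hv
  have hint : IsInterp f (bidiag fun i => (v i : ℂ)) P := by
    intro w hw
    rw [spectrum_bidiag] at hw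
    obtain ⟨i, hi⟩ := hw
    rw [← Subtype.ext hi]
    exact hP i
  have hGv : G (bidiag fun i => (v i : ℂ)) = aeval (bidiag fun i => (v i : ℂ)) P := by
    rw [hGg ⟨_, diagMat_subset_extMat _ _ (hdiag v hv)⟩, ← fOpDiag_eq f _ ⟨_, hdiag v hv⟩ P hint]
    exact h ⟨_, hdiag v hv⟩
  rw [← aeval_bidiag_eq_dividedDiff hv hP, ← hGv]
  rfl

end Calculus

end MatCalc

theorem proposition4p5 (Ω : Set ℂ) (f : Ω → ℂ) (k : ℕ) (hk : 2 ≤ k) :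
    List.TFAE [
      ∃ g : MatCalc.extMat Ω k → Matrix (Fin k) (Fin k) ℂ, Continuous g ∧
        ∀ X : MatCalc.diagMat Ω k,
          g (Set.inclusion (MatCalc.diagMat_subset_extMat Ω k) X) = MatCalc.fOpDiag f k X,
      MatCalc.IsTC f (k - 1) ∧ Continuous (MatCalc.fOp f k),
      MatCalc.IsDDC f (k - 1)] := by
  obtain ⟨m, rfl⟩ : ∃ m, k = m + 1 := ⟨k - 1, by omega⟩
  rw [Nat.add_sub_cancel]
  tfae_have 1 → 3 := fun ⟨_, hg, h⟩ => MatCalc.isDDC_of_continuous_extension hg h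
  tfae_have 3 → 2 := fun hf => ⟨hf.isTC, hf.continuous_fOp le_rfl⟩
  tfae_have 2 → 1 := fun h => ⟨_, h.2, MatCalc.fOp_inclusion f (m + 1)⟩
  tfae_finish
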